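/- Theorem 1.1. For a graph $G$ and a positive integer $r$, let $\mathrm{tc}_r(G)$ be the minimum integer $m$ such that, for every colouring of the edges of $G$ with $r$ colours (not necessarily proper, and not necessarily using every colour), all vertices of $G$ can be covered by at most $m$ monochromatic components. Here a monochromatic component is a connected component of the spanning subgraph of $G$ formed by all edges of one colour; it may consist of a single vertex. Let $\mathcal{G}(n,p)$ be the random graph on $n$ vertices in which each pair of vertices forms an edge independently with probability $p$; it has a property with high probability (w.h.p.) if the probability of this tends to $1$ as $n\to\infty$. The threshold for the property $\mathrm{tc}_3(\mathcal{G}(n,p))\le 3$ is $p^*(n)=\left(\frac{\log n}{n}\right)^{1/4}$. That is, this property of graphs is preserved under adding edges (on the same vertex set), and there are constants $C,c>0$ such that, for every function $p=p(n)\in[0,1]$, 1. if $p(n) > C\left(\frac{\log n}{n}\right)^{1/4}$ for all sufficiently large $n$, then w.h.p. $\mathrm{tc}_3(\mathcal{G}(n,p))\le 3$; 2. if $p(n) < c\left(\frac{\log n}{n}\right)^{1/4}$ for all sufficiently large $n$, then w.h.p. $\mathrm{tc}_3(\mathcal{G}(n,p))> 3$. -/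

import Mathlib

open Filter Topology

/-- A monochromatic component of an edge-colouring `c` of `G` with colours in `K`: a colour `k`
together with a connected component of the spanning subgraph formed by all edges of colour `k`
(so a component may consist of a single vertex). -/
abbrev MonoComponent {V K : Type*} {G : SimpleGraph V} (c : G.EdgeLabeling K) : Type _ :=
  Σ k : K, (c.labelGraph k).ConnectedComponent

/-- The vertex set of a monochromatic component. -/
def MonoComponent.verts {V K : Type*} {G : SimpleGraph V} {c : G.EdgeLabeling K}
    (A : MonoComponent c) : Set V :=
  A.2.supp

/-- The vertices of `G` can be covered by at most `m` monochromatic components of `c`. -/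
def CoverableBy {V K : Type*} {G : SimpleGraph V} (c : G.EdgeLabeling K) (m : ℕ∞) : Prop :=
  ∃ S : Set (MonoComponent c), S.encard ≤ m ∧ ∀ v : V, ∃ A ∈ S, v ∈ A.verts

/-- `tc r G`: the minimum `m` such that, for every colouring (not necessarily proper, not
necessarily using all colours) of the edges of `G` with `r` colours, the vertices of `G` can be
covered by `m` monochromatic components. -/
noncomputable def tc {V : Type*} (r : ℕ) (G : SimpleGraph V) : ℕ∞ :=
  sInf {m : ℕ∞ | ∀ c : G.EdgeLabeling (Fin r), CoverableBy c m}

/-- The binomial random graph `G(n, p(n))` on the vertex set `Fin n` has property `P` with high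
probability: the probability of `P` tends to `1` as `n → ∞`. -/
def WithHighProb (p : ℕ → unitInterval) (P : ∀ n : ℕ, Set (SimpleGraph (Fin n))) : Prop :=
  Tendsto (fun n => SimpleGraph.binomialRandom (Fin n) (p n) (P n)) atTop (𝓝 1)

/-- `q : ℕ → [0, 1]` is the threshold for the increasing graph property `P`. -/
structure IsThreshold (P : ∀ n : ℕ, Set (SimpleGraph (Fin n))) (q : ℕ → ℝ) : Prop where
  increasing : ∀ n, IsUpperSet (P n)
  mem_Icc : ∀ n, q n ∈ Set.Icc (0 : ℝ) 1
  exists_const : ∃ C c : ℝ, 0 < C ∧ 0 < c ∧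
    (∀ p : ℕ → unitInterval, (∀ᶠ n in atTop, C * q n < (p n : ℝ)) → WithHighProb p P) ∧
    (∀ p : ℕ → unitInterval, (∀ᶠ n in atTop, (p n : ℝ) < c * q n) →
      WithHighProb p fun n => (P n)ᶜ)

/-! ### Almost intersecting families of label triples. -/

section Structure

variable {V α : Type*}

theorem ncard_le_sum_of_forall_exists [Finite V] {P : V → Prop} (Qs : List (V → Prop))
    (h : ∀ v, P v → ∃ Q ∈ Qs, Q v) :
    {v | P v}.ncard ≤ (Qs.map fun Q => {v | Q v}.ncard).sum := by
  induction Qs generalizing P with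
  | nil =>
    have : {v | P v} = ∅ := by
      ext v
      simpa using h v
    simp [this]
  | cons Q Qs ih =>
    have h1 : {v | P v} ⊆ {v | Q v} ∪ {v | ∃ Q ∈ Qs, Q v} := by
      intro v hv
      simpa using h v hv
    have h2 := ih (P := fun v => ∃ Q ∈ Qs, Q v) fun v hv => hv
    simp only [List.map_cons, List.sum_cons]
    exact (Set.ncard_le_ncard h1 (Set.toFinite _)).trans
      ((Set.ncard_union_le _ _).trans (by omega))

theorem exists_concentrated_or_split [Finite V] (P : V → Prop) (z : V → α) {L : ℕ}
    (hP : 3 * L ≤ {v | P v}.ncard) :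
    (∃ e, {v | P v ∧ z v ≠ e}.ncard < L) ∨
      ∃ S : Set α, L ≤ {v | P v ∧ z v ∈ S}.ncard ∧ L ≤ {v | P v ∧ z v ∉ S}.ncard := by
  classical
  by_contra! h
  obtain ⟨hc, hs⟩ := h
  have hex : ∃ S : Finset α, L ≤ {v | P v ∧ z v ∈ S}.ncard := by
    refine ⟨(Set.toFinite (Set.range z)).toFinset, ?_⟩
    simp only [Set.Finite.mem_toFinset, Set.mem_range, exists_apply_eq_apply, and_true]
    omega
  -- Without a split, S carries more than 2L vertices. By minimality, dropping one value e leaves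
  -- fewer than L, so e alone carries at least L and everything else fewer than L.
  obtain ⟨S, hS, hmin⟩ := exists_minimalFor_of_wellFoundedLT
    (fun S : Finset α => L ≤ {v | P v ∧ z v ∈ S}.ncard) Finset.card hex
  have h1 := hs S hS
  have h2 := ncard_le_sum_of_forall_exists (P := P)
    [fun v => P v ∧ z v ∈ S, fun v => P v ∧ z v ∉ S] (by simp; tauto)
  simp only [List.map_cons, List.map_nil, List.sum_cons, List.sum_nil] at h2
  obtain ⟨e, he⟩ : S.Nonempty := by
    rw [Finset.nonempty_iff_ne_empty]
    rintro rfl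
    simp at hS
    omega
  have h3 : {v | P v ∧ z v ∈ S.erase e}.ncard < L := by
    by_contra! h3
    have := hmin h3 (Finset.card_erase_le)
    have := Finset.card_erase_lt_of_mem he
    omega
  have h4 := ncard_le_sum_of_forall_exists (P := fun v => P v ∧ z v ∈ S)
    [fun v => P v ∧ z v ∈ S.erase e, fun v => P v ∧ z v ∈ ({e} : Set α)] (by simp; tauto)
  simp only [List.map_cons, List.map_nil, List.sum_cons, List.sum_nil] at h4
  simp only [Finset.mem_coe] at h1
  have h5 := hs {e} (by omega)
  have h6 := hc e
  simp only [Set.mem_singleton_iff, ← ne_eq] at h5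
  omega

/-- Any two sets of at least `L` vertices contain vertices agreeing in one of the labels. -/
def CrossMeeting (L : ℕ) (x y z : V → α) : Prop :=
  ∀ A B : Set V, L ≤ A.ncard → L ≤ B.ncard →
    ∃ a ∈ A, ∃ b ∈ B, x a = x b ∨ y a = y b ∨ z a = z b

theorem CrossMeeting.rotate {L : ℕ} {x y z : V → α} (h : CrossMeeting L x y z) :
    CrossMeeting L y z x := by
  intro A B hA hB
  obtain ⟨a, ha, b, hb, h⟩ := h A B hA hB
  exact ⟨a, ha, b, hb, by tauto⟩

theorem CrossMeeting.swap {L : ℕ} {x y z : V → α} (h : CrossMeeting L x y z) :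
    CrossMeeting L y x z := by
  intro A B hA hB
  obtain ⟨a, ha, b, hb, h⟩ := h A B hA hB
  exact ⟨a, ha, b, hb, by tauto⟩

theorem CrossMeeting.ncard_lt {L : ℕ} {x y z : V → α} (h : CrossMeeting L x y z)
    {P Q : V → Prop} (hP : L ≤ {v | P v}.ncard) (hx : ∀ u v, P u → Q v → x u ≠ x v)
    (hy : ∀ u v, P u → Q v → y u ≠ y v) (hz : ∀ u v, P u → Q v → z u ≠ z v) :
    {v | Q v}.ncard < L := by
  by_contra! hL
  obtain ⟨a, ha, b, hb, hab⟩ := h _ _ hP hL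
  have h1 := hx a b ha hb
  have h2 := hy a b ha hb
  have h3 := hz a b ha hb
  tauto

/-- Vertices of `P` and `Q` can meet only in `z`. If `z` split `P` by a set S, both the part of `Q`
inside S and the part outside would be small; so `z` concentrates on `P`, and its main value is
forced on `Q`. -/
theorem CrossMeeting.exists_common_label [Finite V] {L : ℕ} {x y z : V → α}
    (h : CrossMeeting L x y z) {P Q : V → Prop} (hP : 3 * L ≤ {v | P v}.ncard)
    (hQ : 3 * L ≤ {v | Q v}.ncard) (hx : ∀ u v, P u → Q v → x u ≠ x v)
    (hy : ∀ u v, P u → Q v → y u ≠ y v) :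
    ∃ e, {v | P v ∧ z v ≠ e}.ncard < L ∧ {v | Q v ∧ z v ≠ e}.ncard < L := by
  rcases exists_concentrated_or_split _ z hP with ⟨e, he⟩ | ⟨S, hS, hS'⟩
  · have h1 := ncard_le_sum_of_forall_exists (P := P)
      [fun v => P v ∧ z v = e, fun v => P v ∧ z v ≠ e] (by simp; tauto)
    simp only [List.map_cons, List.map_nil, List.sum_cons, List.sum_nil] at h1
    refine ⟨e, he, h.ncard_lt (P := fun v => P v ∧ z v = e) (by omega)
      (fun u v hu hv => hx u v hu.1 hv.1) (fun u v hu hv => hy u v hu.1 hv.1) ?_⟩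
    rintro u v ⟨-, rfl⟩ ⟨-, hv⟩
    exact hv.symm
  · have h1 := h.ncard_lt (Q := fun v => Q v ∧ z v ∉ S) hS
      (fun u v hu hv => hx u v hu.1 hv.1) (fun u v hu hv => hy u v hu.1 hv.1)
      (by rintro u v ⟨-, hu⟩ ⟨-, hv⟩ huv; exact hv (huv ▸ hu))
    have h2 := h.ncard_lt (Q := fun v => Q v ∧ z v ∈ S) hS'
      (fun u v hu hv => hx u v hu.1 hv.1) (fun u v hu hv => hy u v hu.1 hv.1)
      (by rintro u v ⟨-, hu⟩ ⟨-, hv⟩ huv; exact hu (huv ▸ hv))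
    have h3 := ncard_le_sum_of_forall_exists (P := Q)
      [fun v => Q v ∧ z v ∉ S, fun v => Q v ∧ z v ∈ S] (by simp; tauto)
    simp only [List.map_cons, List.map_nil, List.sum_cons, List.sum_nil] at h3
    omega

/-- All but at most `10 * L` vertices have the label `a`. -/
def AlmostStar (L : ℕ) (x : V → α) : Prop :=
  ∃ a, {v | x v ≠ a}.ncard ≤ 10 * L

/-- At least two of the three labels of `v` are `a`, `b`, `d`, respectively. -/
def TwoOf (x y z : V → α) (a b d : α) (v : V) : Prop :=
  x v = a ∧ y v = b ∨ x v = a ∧ z v = d ∨ y v = b ∧ z v = d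

/-- All but at most `10 * L` vertices agree with a fixed triple in at least two labels. -/
def AlmostTriangle (L : ℕ) (x y z : V → α) : Prop :=
  ∃ a b d, {v | ¬ TwoOf x y z a b d v}.ncard ≤ 10 * L

/-- The labels of `v` form one of the edges of the truncated Fano plane on `a, a', b, b', d, d'`. -/
def FanoEdge (x y z : V → α) (a a' b b' d d' : α) (v : V) : Prop :=
  x v = a ∧ y v = b ∧ z v = d ∨ x v = a ∧ y v = b' ∧ z v = d' ∨
    x v = a' ∧ y v = b ∧ z v = d' ∨ x v = a' ∧ y v = b' ∧ z v = d

/-- All but at most `10 * L` vertices are labelled by the edges of a truncated Fano plane. -/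
def AlmostFano (L : ℕ) (x y z : V → α) : Prop :=
  ∃ a a' b b' d d', a ≠ a' ∧ b ≠ b' ∧ d ≠ d' ∧
    {v | ¬ FanoEdge x y z a a' b b' d d' v}.ncard ≤ 10 * L

/-- Up to at most `10 * L` vertices, the labels form an intersecting family. -/
def Structured (L : ℕ) (x y z : V → α) : Prop :=
  AlmostStar L x ∨ AlmostStar L y ∨ AlmostStar L z ∨ AlmostTriangle L x y z ∨ AlmostFano L x y z

theorem Structured.rotate {L : ℕ} {x y z : V → α} (h : Structured L x y z) :
    Structured L y z x := by
  rcases h with h | h | h | ⟨a, b, d, h⟩ | ⟨a, a', b, b', d, d', h1, h2, h3, h⟩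
  · exact .inr (.inr (.inl h))
  · exact .inl h
  · exact .inr (.inl h)
  · refine .inr (.inr (.inr (.inl ⟨b, d, a, ?_⟩)))
    convert h using 4 with v
    simp only [TwoOf]
    tauto
  · refine .inr (.inr (.inr (.inr ⟨b, b', d, d', a, a', h2, h3, h1, ?_⟩)))
    convert h using 4 with v
    simp only [FanoEdge]
    tauto

theorem Structured.swap {L : ℕ} {x y z : V → α} (h : Structured L x y z) :
    Structured L y x z := by
  rcases h with h | h | h | ⟨a, b, d, h⟩ | ⟨a, a', b, b', d, d', h1, h2, h3, h⟩
  · exact .inr (.inl h)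
  · exact .inl h
  · exact .inr (.inr (.inl h))
  · refine .inr (.inr (.inr (.inl ⟨b, a, d, ?_⟩)))
    convert h using 4 with v
    simp only [TwoOf]
    tauto
  · refine .inr (.inr (.inr (.inr ⟨b, b', a, a', d, d', h2, h1, h3, ?_⟩)))
    convert h using 4 with v
    simp only [FanoEdge]
    tauto

/-- Sort the vertices by which of a, b, d they carry. Complementary types never meet, so a large
type makes its complement small, and two large single-label types share their third label. If the
third single-label type is small, this gives a triangle; otherwise the shared labels a', b', d'
complete a truncated Fano plane. The Fano case discards ten sets of fewer than L vertices each,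
whence 10 * L. -/
theorem CrossMeeting.structured_of_two_large [Finite V] {L : ℕ} {x y z : V → α}
    (h : CrossMeeting L x y z) {a b d : α} (ht : {v | x v ≠ a ∧ y v ≠ b ∧ z v ≠ d}.ncard < L)
    (hx : 3 * L ≤ {v | x v = a ∧ y v ≠ b ∧ z v ≠ d}.ncard)
    (hy : 3 * L ≤ {v | x v ≠ a ∧ y v = b ∧ z v ≠ d}.ncard) : Structured L x y z := by
  have hyz : {v | x v ≠ a ∧ y v = b ∧ z v = d}.ncard < L :=
    h.ncard_lt (P := fun v => x v = a ∧ y v ≠ b ∧ z v ≠ d) (by omega)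
      (by grind) (by grind) (by grind)
  have hxz : {v | x v = a ∧ y v ≠ b ∧ z v = d}.ncard < L :=
    h.ncard_lt (P := fun v => x v ≠ a ∧ y v = b ∧ z v ≠ d) (by omega)
      (by grind) (by grind) (by grind)
  obtain ⟨d', hd1, hd2⟩ := h.exists_common_label (P := fun v => x v = a ∧ y v ≠ b ∧ z v ≠ d)
    (Q := fun v => x v ≠ a ∧ y v = b ∧ z v ≠ d) hx hy (by grind) (by grind)
  by_cases hz : {v | x v ≠ a ∧ y v ≠ b ∧ z v = d}.ncard < 3 * L
  · refine .inr (.inr (.inr (.inl ⟨a, b, d', ?_⟩)))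
    have := ncard_le_sum_of_forall_exists (P := fun v => ¬ TwoOf x y z a b d' v)
      [fun v => x v ≠ a ∧ y v ≠ b ∧ z v ≠ d, fun v => x v ≠ a ∧ y v = b ∧ z v = d,
        fun v => x v = a ∧ y v ≠ b ∧ z v = d,
        fun v => (x v = a ∧ y v ≠ b ∧ z v ≠ d) ∧ z v ≠ d',
        fun v => (x v ≠ a ∧ y v = b ∧ z v ≠ d) ∧ z v ≠ d',
        fun v => x v ≠ a ∧ y v ≠ b ∧ z v = d] (by
          intro v
          simp only [TwoOf, List.mem_cons, List.not_mem_nil, or_false, exists_eq_or_imp,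
            exists_eq_left]
          grind)
    simp only [List.map_cons, List.map_nil, List.sum_cons, List.sum_nil] at this
    omega
  · push Not at hz
    have hxy : {v | x v = a ∧ y v = b ∧ z v ≠ d}.ncard < L :=
      h.ncard_lt (P := fun v => x v ≠ a ∧ y v ≠ b ∧ z v = d) (by omega)
        (by grind) (by grind) (by grind)
    obtain ⟨b', hb1, hb2⟩ := h.rotate.rotate.exists_common_label
      (P := fun v => x v = a ∧ y v ≠ b ∧ z v ≠ d) (Q := fun v => x v ≠ a ∧ y v ≠ b ∧ z v = d)
      hx hz (by grind) (by grind)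
    obtain ⟨a', ha1, ha2⟩ := h.rotate.exists_common_label
      (P := fun v => x v ≠ a ∧ y v = b ∧ z v ≠ d) (Q := fun v => x v ≠ a ∧ y v ≠ b ∧ z v = d)
      hy hz (by grind) (by grind)
    have hne : ∀ (P : V → Prop) (w : V → α) (e f : α), 3 * L ≤ {v | P v}.ncard →
        (∀ v, P v → w v ≠ e) → {v | P v ∧ w v ≠ f}.ncard < L → e ≠ f := by
      rintro P w e f hP hw hf rfl
      have : {v | P v}.ncard ≤ {v | P v ∧ w v ≠ e}.ncard :=
        Set.ncard_le_ncard (fun v hv => ⟨hv, hw v hv⟩) (Set.toFinite _)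
      omega
    refine .inr (.inr (.inr (.inr ⟨a, a', b, b', d, d', hne _ x _ _ hy (by tauto) ha1,
      hne _ y _ _ hx (by tauto) hb1, hne _ z _ _ hx (by tauto) hd1, ?_⟩)))
    have := ncard_le_sum_of_forall_exists (P := fun v => ¬ FanoEdge x y z a a' b b' d d' v)
      [fun v => x v ≠ a ∧ y v ≠ b ∧ z v ≠ d, fun v => x v ≠ a ∧ y v = b ∧ z v = d,
        fun v => x v = a ∧ y v ≠ b ∧ z v = d, fun v => x v = a ∧ y v = b ∧ z v ≠ d,
        fun v => (x v = a ∧ y v ≠ b ∧ z v ≠ d) ∧ z v ≠ d',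
        fun v => (x v ≠ a ∧ y v = b ∧ z v ≠ d) ∧ z v ≠ d',
        fun v => (x v = a ∧ y v ≠ b ∧ z v ≠ d) ∧ y v ≠ b',
        fun v => (x v ≠ a ∧ y v ≠ b ∧ z v = d) ∧ y v ≠ b',
        fun v => (x v ≠ a ∧ y v = b ∧ z v ≠ d) ∧ x v ≠ a',
        fun v => (x v ≠ a ∧ y v ≠ b ∧ z v = d) ∧ x v ≠ a'] (by
          intro v
          simp only [FanoEdge, List.mem_cons, List.not_mem_nil, or_false, exists_eq_or_imp,
            exists_eq_left]
          grind)
    simp only [List.map_cons, List.map_nil, List.sum_cons, List.sum_nil] at this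
    omega

theorem CrossMeeting.structured_of_one_large [Finite V] {L : ℕ} {x y z : V → α}
    (h : CrossMeeting L x y z) {a b d : α} (ht : {v | x v ≠ a ∧ y v ≠ b ∧ z v ≠ d}.ncard < L)
    (hx : 3 * L ≤ {v | x v = a ∧ y v ≠ b ∧ z v ≠ d}.ncard) : Structured L x y z := by
  by_cases hy : {v | x v ≠ a ∧ y v = b ∧ z v ≠ d}.ncard < 3 * L
  · by_cases hz : {v | x v ≠ a ∧ y v ≠ b ∧ z v = d}.ncard < 3 * L
    · refine .inl ⟨a, ?_⟩
      have hyz : {v | x v ≠ a ∧ y v = b ∧ z v = d}.ncard < L :=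
        h.ncard_lt (P := fun v => x v = a ∧ y v ≠ b ∧ z v ≠ d) (by omega)
          (by grind) (by grind) (by grind)
      have := ncard_le_sum_of_forall_exists (P := fun v => x v ≠ a)
        [fun v => x v ≠ a ∧ y v ≠ b ∧ z v ≠ d, fun v => x v ≠ a ∧ y v = b ∧ z v ≠ d,
          fun v => x v ≠ a ∧ y v ≠ b ∧ z v = d, fun v => x v ≠ a ∧ y v = b ∧ z v = d]
        (by intro v; simp; tauto)
      simp only [List.map_cons, List.map_nil, List.sum_cons, List.sum_nil] at this
      omega
    · refine (h.rotate.rotate.structured_of_two_large (a := d) (b := a) (d := b) ?_ ?_ ?_).rotate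
      · simpa only [and_assoc, and_comm, and_left_comm] using ht
      · simpa only [and_assoc, and_comm, and_left_comm] using not_lt.1 hz
      · simpa only [and_assoc, and_comm, and_left_comm] using hx
  · exact h.structured_of_two_large ht hx (not_lt.1 hy)

/-- A large class (a, b, d) forces almost every vertex to carry one of its labels. The number of
large types carrying exactly one decides the structure; the triangle with none large costs L + 3 *
3L. -/
theorem CrossMeeting.structured_of_large_class [Finite V] {L : ℕ} {x y z : V → α}
    (h : CrossMeeting L x y z) {a b d : α}
    (hP : L ≤ {v | x v = a ∧ y v = b ∧ z v = d}.ncard) : Structured L x y z := by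
  have ht : {v | x v ≠ a ∧ y v ≠ b ∧ z v ≠ d}.ncard < L :=
    h.ncard_lt (P := fun v => x v = a ∧ y v = b ∧ z v = d) (by omega)
      (by grind) (by grind) (by grind)
  by_cases hx : {v | x v = a ∧ y v ≠ b ∧ z v ≠ d}.ncard < 3 * L
  · by_cases hy : {v | x v ≠ a ∧ y v = b ∧ z v ≠ d}.ncard < 3 * L
    · by_cases hz : {v | x v ≠ a ∧ y v ≠ b ∧ z v = d}.ncard < 3 * L
      · refine .inr (.inr (.inr (.inl ⟨a, b, d, ?_⟩)))
        have := ncard_le_sum_of_forall_exists (P := fun v => ¬ TwoOf x y z a b d v)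
          [fun v => x v ≠ a ∧ y v ≠ b ∧ z v ≠ d, fun v => x v = a ∧ y v ≠ b ∧ z v ≠ d,
            fun v => x v ≠ a ∧ y v = b ∧ z v ≠ d, fun v => x v ≠ a ∧ y v ≠ b ∧ z v = d]
          (by
          intro v
          simp only [TwoOf, List.mem_cons, List.not_mem_nil, or_false, exists_eq_or_imp,
            exists_eq_left]
          grind)
        simp only [List.map_cons, List.map_nil, List.sum_cons, List.sum_nil] at this
        omega
      · refine (h.rotate.rotate.structured_of_one_large (a := d) (b := a) (d := b) ?_ ?_).rotate
        · simpa only [and_assoc, and_comm, and_left_comm] using ht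
        · simpa only [and_assoc, and_comm, and_left_comm] using not_lt.1 hz
    · refine (h.swap.structured_of_one_large (a := b) (b := a) (d := d) ?_ ?_).swap
      · simpa only [and_assoc, and_comm, and_left_comm] using ht
      · simpa only [and_assoc, and_comm, and_left_comm] using not_lt.1 hy
  · exact h.structured_of_one_large ht (not_lt.1 hx)

/-- Either `z` concentrates on the pair class, giving a large class of full triples, or it splits
there, and then few vertices avoid both a and b. -/
theorem CrossMeeting.structured_of_large_pair [Finite V] {L : ℕ} {x y z : V → α}
    (h : CrossMeeting L x y z) {a b : α} (hP : 3 * L ≤ {v | x v = a ∧ y v = b}.ncard) :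
    Structured L x y z := by
  rcases exists_concentrated_or_split _ z hP with ⟨d, hd⟩ | ⟨S, hS, hS'⟩
  · have := ncard_le_sum_of_forall_exists (P := fun v => x v = a ∧ y v = b)
      [fun v => x v = a ∧ y v = b ∧ z v = d, fun v => (x v = a ∧ y v = b) ∧ z v ≠ d]
      (by intro v; simp; tauto)
    simp only [List.map_cons, List.map_nil, List.sum_cons, List.sum_nil] at this
    exact h.structured_of_large_class (a := a) (b := b) (d := d) (by omega)
  · have h1 : {v | (x v ≠ a ∧ y v ≠ b) ∧ z v ∉ S}.ncard < L :=
      h.ncard_lt hS (by grind) (by grind)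
        (by rintro u v ⟨-, hu⟩ ⟨-, hv⟩ huv; exact hv (huv ▸ hu))
    have h2 : {v | (x v ≠ a ∧ y v ≠ b) ∧ z v ∈ S}.ncard < L :=
      h.ncard_lt hS' (by grind) (by grind)
        (by rintro u v ⟨-, hu⟩ ⟨-, hv⟩ huv; exact hu (huv ▸ hv))
    by_cases hx : {v | x v = a ∧ y v ≠ b}.ncard < 3 * L
    · refine .inr (.inl ⟨b, ?_⟩)
      have := ncard_le_sum_of_forall_exists (P := fun v => y v ≠ b)
        [fun v => x v = a ∧ y v ≠ b, fun v => (x v ≠ a ∧ y v ≠ b) ∧ z v ∉ S,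
          fun v => (x v ≠ a ∧ y v ≠ b) ∧ z v ∈ S] (by intro v; simp; tauto)
      simp only [List.map_cons, List.map_nil, List.sum_cons, List.sum_nil] at this
      omega
    by_cases hy : {v | x v ≠ a ∧ y v = b}.ncard < 3 * L
    · refine .inl ⟨a, ?_⟩
      have := ncard_le_sum_of_forall_exists (P := fun v => x v ≠ a)
        [fun v => x v ≠ a ∧ y v = b, fun v => (x v ≠ a ∧ y v ≠ b) ∧ z v ∉ S,
          fun v => (x v ≠ a ∧ y v ≠ b) ∧ z v ∈ S] (by intro v; simp; tauto)
      simp only [List.map_cons, List.map_nil, List.sum_cons, List.sum_nil] at this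
      omega
    obtain ⟨d, hd1, hd2⟩ := h.exists_common_label (P := fun v => x v = a ∧ y v ≠ b)
      (Q := fun v => x v ≠ a ∧ y v = b) (not_lt.1 hx) (not_lt.1 hy) (by grind) (by grind)
    refine .inr (.inr (.inr (.inl ⟨a, b, d, ?_⟩)))
    have := ncard_le_sum_of_forall_exists (P := fun v => ¬ TwoOf x y z a b d v)
      [fun v => (x v ≠ a ∧ y v ≠ b) ∧ z v ∉ S, fun v => (x v ≠ a ∧ y v ≠ b) ∧ z v ∈ S,
        fun v => (x v = a ∧ y v ≠ b) ∧ z v ≠ d, fun v => (x v ≠ a ∧ y v = b) ∧ z v ≠ d]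
      (by
          intro v
          simp only [TwoOf, List.mem_cons, List.not_mem_nil, or_false, exists_eq_or_imp,
            exists_eq_left]
          grind)
    simp only [List.map_cons, List.map_nil, List.sum_cons, List.sum_nil] at this
    omega

end Structure

/-! ### Expansion forces a cover by three label classes. -/

section Labels

variable {V α : Type*} {G : SimpleGraph V} {L : ℕ} {x y z : V → α}

/-- Any two disjoint sets of at least `L` vertices are joined by an edge. -/
def SetsJoined (G : SimpleGraph V) (L : ℕ) : Prop :=
  ∀ A B : Set V, Disjoint A B → L ≤ A.ncard → L ≤ B.ncard → ∃ a ∈ A, ∃ b ∈ B, G.Adj a b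

/-- The neighbourhood of a nonempty set `D` meets every common neighbourhood of three vertices in
more than `min (4 * |D|) (18 * L)` vertices. -/
def Expands (G : SimpleGraph V) (L : ℕ) : Prop :=
  ∀ (a b d : V) (D : Set V), D.Nonempty → min (4 * D.ncard) (18 * L) <
    {u | (G.Adj a u ∧ G.Adj b u ∧ G.Adj d u) ∧ ∃ w ∈ D, G.Adj w u}.ncard

/-- Adjacent vertices agree in one of the labels. -/
def Linked (G : SimpleGraph V) (x y z : V → α) : Prop :=
  ∀ u v, G.Adj u v → x u = x v ∨ y u = y v ∨ z u = z v

/-- No three label classes of the labellings in `W` cover all vertices. -/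
def Uncoverable (W : Set (V → α)) : Prop :=
  ∀ w₁ ∈ W, ∀ w₂ ∈ W, ∀ w₃ ∈ W, ∀ a b d, ∃ v, w₁ v ≠ a ∧ w₂ v ≠ b ∧ w₃ v ≠ d

theorem Linked.rotate (h : Linked G x y z) : Linked G y z x := by
  intro u v huv
  have := h u v huv
  tauto

theorem Uncoverable.rotate (h : Uncoverable {x, y, z}) : Uncoverable {y, z, x} := by
  have : ({y, z, x} : Set (V → α)) = {x, y, z} := by
    ext
    simp only [Set.mem_insert_iff, Set.mem_singleton_iff]
    tauto
  rwa [this]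

theorem SetsJoined.crossMeeting (hG : SetsJoined G L) (h : Linked G x y z) : CrossMeeting L x y z := by
  intro A B hA hB
  by_cases hAB : Disjoint A B
  · obtain ⟨a, ha, b, hb, hab⟩ := hG A B hAB hA hB
    exact ⟨a, ha, b, hb, h a b hab⟩
  · obtain ⟨a, ha, hb⟩ := Set.not_disjoint_iff.1 hAB
    exact ⟨a, ha, a, hb, .inl rfl⟩

theorem Expands.exists_adj₄ (hG : Expands G L) (a b d e : V) :
    ∃ u, G.Adj a u ∧ G.Adj b u ∧ G.Adj d u ∧ G.Adj e u := by
  have h := hG a b d {e} (Set.singleton_nonempty e)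
  obtain ⟨u, ⟨h1, h2, h3⟩, w, rfl, h4⟩ := Set.nonempty_of_ncard_ne_zero h.ne_bot
  exact ⟨u, h1, h2, h3, h4⟩

/-- For D the whole vertex set, 4 * |D| is at least 20 * L, so the cap 18 * L is the minimum. -/
theorem Expands.lt_ncard_commonNbrs [Finite V] (hG : Expands G L) (hV : 5 * L ≤ Nat.card V)
    (a b d : V) : 18 * L < {u | G.Adj a u ∧ G.Adj b u ∧ G.Adj d u}.ncard := by
  have h := hG a b d Set.univ ⟨a, trivial⟩
  rw [Set.ncard_univ] at h
  have := Set.ncard_le_ncard (s := {u | (G.Adj a u ∧ G.Adj b u ∧ G.Adj d u) ∧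
    ∃ w ∈ Set.univ, G.Adj w u}) (t := {u | G.Adj a u ∧ G.Adj b u ∧ G.Adj d u})
    (fun u hu => hu.1) (Set.toFinite _)
  omega

theorem Expands.exists_adj₃_notMem [Finite V] (hG : Expands G L) (hV : 5 * L ≤ Nat.card V)
    {E : Set V} (hE : E.ncard ≤ 10 * L) (a b d : V) :
    ∃ u ∉ E, G.Adj a u ∧ G.Adj b u ∧ G.Adj d u := by
  by_contra! h
  have h1 := hG.lt_ncard_commonNbrs hV a b d
  have h2 := Set.ncard_le_ncard (s := {u | G.Adj a u ∧ G.Adj b u ∧ G.Adj d u}) (t := E)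
    (fun u hu => by_contra fun hE => h u hE hu.1 hu.2.1 hu.2.2) (Set.toFinite _)
  omega

/-- Four common neighbourhoods that are pure outside a small set `E` cannot contain a vertex
of `E`. -/
theorem Expands.false_of_pure_commonNbrs [Finite V] (hG : Expands G L) {E : Set V}
    (hE : E.ncard ≤ 10 * L) (p q r : Fin 4 → V) (t : Fin 4 → V → Prop)
    (ht : ∀ j u, u ∉ E → G.Adj (p j) u → G.Adj (q j) u → G.Adj (r j) u →
      ∀ w, G.Adj w u → t j w)
    (hmiss : ∀ w ∈ E, ∃ j, ¬ t j w)
    (hex : ∃ j, ∃ w ∈ E, G.Adj (p j) w ∧ G.Adj (q j) w ∧ G.Adj (r j) w) : False := by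
  let A : Fin 4 → Set V := fun j => {w | w ∈ E ∧ G.Adj (p j) w ∧ G.Adj (q j) w ∧ G.Adj (r j) w}
  -- In the largest A i, at least a quarter of the vertices fail the same `t j`. By purity, their
  -- neighbours in the j-th common neighbourhood lie in `E`, hence in A j. Expansion by the factor 4
  -- makes A j larger than A i, or else larger than 18 * L, exceeding `E`.
  obtain ⟨i, -, hi⟩ := Finset.exists_max_image Finset.univ (fun j => (A j).ncard) ⟨0, by simp⟩
  obtain ⟨j₀, w₀, hw₀⟩ := hex
  have hpos : 0 < (A i).ncard :=
    (Set.ncard_pos (Set.toFinite _)).2 ⟨w₀, hw₀⟩ |>.trans_le (hi j₀ (by simp))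
  have hsum := ncard_le_sum_of_forall_exists (P := fun w => w ∈ A i)
    [fun w => w ∈ A i ∧ ¬ t 0 w, fun w => w ∈ A i ∧ ¬ t 1 w, fun w => w ∈ A i ∧ ¬ t 2 w,
      fun w => w ∈ A i ∧ ¬ t 3 w] (by
        intro w hw
        obtain ⟨j, hj⟩ := hmiss w hw.1
        fin_cases j <;> simp_all)
  simp only [List.map_cons, List.map_nil, List.sum_cons, List.sum_nil] at hsum
  obtain ⟨j, hj⟩ : ∃ j, (A i).ncard ≤ 4 * {w | w ∈ A i ∧ ¬ t j w}.ncard := by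
    by_contra! h
    have := h 0
    have := h 1
    have := h 2
    have := h 3
    simp only [Set.ofPred_mem_eq] at hsum
    omega
  have h1 := hG (p j) (q j) (r j) {w | w ∈ A i ∧ ¬ t j w}
    ((Set.ncard_pos (Set.toFinite _)).1 (by omega))
  have h2 : {u | (G.Adj (p j) u ∧ G.Adj (q j) u ∧ G.Adj (r j) u) ∧
      ∃ w ∈ {w | w ∈ A i ∧ ¬ t j w}, G.Adj w u}.ncard ≤ (A j).ncard := by
    refine Set.ncard_le_ncard ?_ (Set.toFinite _)
    rintro u ⟨hu, w, hw, hwu⟩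
    refine ⟨?_, hu⟩
    by_contra hE
    exact hw.2 (ht j u hE hu.1 hu.2.1 hu.2.2 w hwu)
  have h3 := hi j (by simp)
  have h4 : (A j).ncard ≤ E.ncard := Set.ncard_le_ncard (fun u hu => hu.1) (Set.toFinite _)
  omega

/-- Off the class a, the pairs of labels (`y`, `z`) are edges of a bipartite graph. Three such
vertices have a common neighbour labelled a, which meets each of them in `y` or `z`, so two of them
share a label. Thus there is no matching of size three, and as in König's theorem two labels cover
the rest. -/
theorem Expands.false_of_almostStar [Finite V] (hG : Expands G L) (hV : 5 * L ≤ Nat.card V)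
    (hlink : Linked G x y z) (hunc : Uncoverable {x, y, z}) : ¬ AlmostStar L x := by
  rintro ⟨a, ha⟩
  have key : ∀ u v w, x u ≠ a → x v ≠ a → x w ≠ a →
      y u = y v ∨ y v = y w ∨ y u = y w ∨ z u = z v ∨ z v = z w ∨ z u = z w := by
    intro u v w hu hv hw
    obtain ⟨s, hs, h1, h2, h3⟩ := hG.exists_adj₃_notMem hV ha u v w
    have h1 := hlink _ _ h1
    have h2 := hlink _ _ h2
    have h3 := hlink _ _ h3
    simp only [ne_eq, Set.mem_ofPred_eq, not_not] at hs
    grind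
  have hx : x ∈ ({x, y, z} : Set (V → α)) := by simp
  have hy : y ∈ ({x, y, z} : Set (V → α)) := by simp
  have hz : z ∈ ({x, y, z} : Set (V → α)) := by simp
  obtain ⟨u, hu, -, -⟩ := hunc x hx x hx x hx a a a
  obtain ⟨v, hv1, hv2, hv3⟩ := hunc x hx y hy z hz a (y u) (z u)
  -- The labels of u and v give four candidate covers with one label from each; b₁, ..., b₄ witness
  -- that none of them works together with a.
  obtain ⟨b₁, hb1⟩ := hunc x hx y hy y hy a (y u) (y v)
  obtain ⟨b₂, hb2⟩ := hunc x hx z hz z hz a (z u) (z v)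
  obtain ⟨b₃, hb3⟩ := hunc x hx y hy z hz a (y u) (z v)
  obtain ⟨b₄, hb4⟩ := hunc x hx y hy z hz a (y v) (z u)
  have k1 := key u v b₁ hu hv1 hb1.1
  have k2 := key u v b₂ hu hv1 hb2.1
  have k3 := key u v b₃ hu hv1 hb3.1
  have k4 := key u v b₄ hu hv1 hb4.1
  have k5 := key u b₁ b₂ hu hb1.1 hb2.1
  have k6 := key u b₁ b₃ hu hb1.1 hb3.1
  have k7 := key u b₁ b₄ hu hb1.1 hb4.1
  have k8 := key u b₂ b₃ hu hb2.1 hb3.1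
  have k9 := key u b₂ b₄ hu hb2.1 hb4.1
  have k10 := key u b₃ b₄ hu hb3.1 hb4.1
  have k11 := key v b₁ b₂ hv1 hb1.1 hb2.1
  have k12 := key v b₁ b₃ hv1 hb1.1 hb3.1
  have k13 := key v b₁ b₄ hv1 hb1.1 hb4.1
  have k14 := key v b₂ b₃ hv1 hb2.1 hb3.1
  have k15 := key v b₂ b₄ hv1 hb2.1 hb4.1
  have k16 := key v b₃ b₄ hv1 hb3.1 hb4.1
  have k17 := key b₁ b₂ b₃ hb1.1 hb2.1 hb3.1
  have k18 := key b₁ b₂ b₄ hb1.1 hb2.1 hb4.1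
  have k19 := key b₁ b₃ b₄ hb1.1 hb3.1 hb4.1
  have k20 := key b₂ b₃ b₄ hb2.1 hb3.1 hb4.1
  clear key hlink hunc
  grind

/-- If u, v, w differ from s in `x`, `y`, `z` respectively, the triples containing s are forced to
agree in the remaining labels, and then u, v, w agree in none. -/
theorem exists_common_label_of_forall_three (S : Set V) (hS : S.Nonempty)
    (h : ∀ u ∈ S, ∀ v ∈ S, ∀ w ∈ S,
      x u = x v ∧ x u = x w ∨ y u = y v ∧ y u = y w ∨ z u = z v ∧ z u = z w) :
    ∃ s ∈ S, (∀ v ∈ S, x v = x s) ∨ (∀ v ∈ S, y v = y s) ∨ (∀ v ∈ S, z v = z s) := by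
  obtain ⟨s, hs⟩ := hS
  refine ⟨s, hs, ?_⟩
  by_contra! hc
  obtain ⟨⟨u, hu, hu'⟩, ⟨v, hv, hv'⟩, ⟨w, hw, hw'⟩⟩ := hc
  have h1 := h s hs u hu v hv
  have h2 := h s hs u hu w hw
  have h3 := h s hs v hv w hw
  have h4 := h u hu v hv w hw
  grind

/-- Vertices p, q, r escape the covers that combine the common label of s with two of a, b, d; each
must carry the third of these. Outside the exceptional set, common neighbours of three of p, q, r, s
have labels meeting all three, which leaves one triple: (a, b, d), or this with one entry replaced
by that of s. A vertex meeting all four such triples has two of the labels a, b, d, so exceptional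
vertices always miss one. -/
theorem Expands.false_of_triangle_of_common_label [Finite V] (hG : Expands G L)
    (hlink : Linked G x y z) (hunc : Uncoverable {x, y, z}) {a b d : α}
    (hE : {v | ¬ TwoOf x y z a b d v}.ncard ≤ 10 * L) {s : V}
    (hs : x s ≠ a ∧ y s ≠ b ∧ z s ≠ d)
    (hcommon : ∀ v, x v ≠ a → y v ≠ b → z v ≠ d → z v = z s) : False := by
  have hx : x ∈ ({x, y, z} : Set (V → α)) := by simp
  have hy : y ∈ ({x, y, z} : Set (V → α)) := by simp
  have hz : z ∈ ({x, y, z} : Set (V → α)) := by simp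
  obtain ⟨p, hp1, hp2, hp3⟩ := hunc x hx y hy z hz a b (z s)
  obtain ⟨q, hq1, hq2, hq3⟩ := hunc x hx z hz z hz a d (z s)
  obtain ⟨r, hr1, hr2, hr3⟩ := hunc y hy z hz z hz b d (z s)
  have hp : z p = d := by
    by_contra hne
    exact hp3 (hcommon p hp1 hp2 hne)
  have hq : y q = b := by
    by_contra hne
    exact hq3 (hcommon q hq1 hne hq2)
  have hr : x r = a := by
    by_contra hne
    exact hr3 (hcommon r hne hr1 hr2)
  obtain ⟨w, hw1, hw2, hw3, hw4⟩ := hG.exists_adj₄ r q p s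
  have hwE : ¬ TwoOf x y z a b d w := by
    have h1 := hlink _ _ hw1
    have h2 := hlink _ _ hw2
    have h3 := hlink _ _ hw3
    have h4 := hlink _ _ hw4
    unfold TwoOf
    grind
  refine hG.false_of_pure_commonNbrs hE ![r, s, s, s] ![q, r, r, q] ![p, q, p, p]
    ![fun w => x w = a ∨ y w = b ∨ z w = d, fun w => x w = a ∨ y w = b ∨ z w = z s,
      fun w => x w = a ∨ y w = y s ∨ z w = d, fun w => x w = x s ∨ y w = b ∨ z w = d] ?_ ?_
    ⟨0, w, hwE, hw1, hw2, hw3⟩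
  · intro j u hu h1 h2 h3 v hv
    have h1 := hlink _ _ h1
    have h2 := hlink _ _ h2
    have h3 := hlink _ _ h3
    have h4 := hlink _ _ hv
    simp only [Set.mem_ofPred_eq, not_not, TwoOf] at hu
    fin_cases j <;> simp at h1 h2 h3 ⊢ <;> grind
  · intro u hu
    simp only [Set.mem_ofPred_eq, TwoOf] at hu
    by_contra! h
    have h0 := h 0
    have h1 := h 1
    have h2 := h 2
    have h3 := h 3
    simp at h0 h1 h2 h3
    grind

theorem Expands.false_of_almostTriangle [Finite V] (hG : Expands G L) (hV : 5 * L ≤ Nat.card V)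
    (hlink : Linked G x y z) (hunc : Uncoverable {x, y, z}) : ¬ AlmostTriangle L x y z := by
  rintro ⟨a, b, d, hE⟩
  obtain ⟨s₀, hs₀⟩ := hunc x (by simp) y (by simp) z (by simp) a b d
  obtain ⟨s, hs, h⟩ := exists_common_label_of_forall_three (x := x) (y := y) (z := z)
    -- A common neighbour outside the exceptional set has two of a, b, d, which u, v, w lack; all
    -- three must therefore share its remaining label.
    {v | x v ≠ a ∧ y v ≠ b ∧ z v ≠ d} ⟨s₀, hs₀⟩ (by
      intro u hu v hv w hw
      obtain ⟨t, ht, h1, h2, h3⟩ := hG.exists_adj₃_notMem hV hE u v w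
      have h1 := hlink _ _ h1
      have h2 := hlink _ _ h2
      have h3 := hlink _ _ h3
      simp only [Set.mem_ofPred_eq, not_not, TwoOf] at hu hv hw ht
      grind)
  simp only [Set.mem_ofPred_eq] at hs h
  have hE' : {v | ¬ TwoOf y z x b d a v}.ncard ≤ 10 * L := by
    convert hE using 4 with v
    simp only [TwoOf]
    tauto
  have hE'' : {v | ¬ TwoOf z x y d a b v}.ncard ≤ 10 * L := by
    convert hE using 4 with v
    simp only [TwoOf]
    tauto
  rcases h with h | h | h
  · exact hG.false_of_triangle_of_common_label hlink.rotate hunc.rotate hE'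
      (by tauto) (fun v h1 h2 h3 => h v ⟨h3, h1, h2⟩)
  · exact hG.false_of_triangle_of_common_label hlink.rotate.rotate hunc.rotate.rotate hE''
      (by tauto) (fun v h1 h2 h3 => h v ⟨h2, h3, h1⟩)
  · exact hG.false_of_triangle_of_common_label hlink hunc hE hs
      (fun v h1 h2 h3 => h v ⟨h1, h2, h3⟩)

/-- Each of p, q, r, s misses one edge of the truncated Fano plane, so a non-exceptional common
neighbour of three of them is labelled by the fourth edge. The plane is maximal intersecting: a
triple with one label per part that meets all four edges is one of them. -/
theorem Expands.false_of_almostFano [Finite V] (hG : Expands G L)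
    (hlink : Linked G x y z) (hunc : Uncoverable {x, y, z}) : ¬ AlmostFano L x y z := by
  rintro ⟨a, a', b, b', d, d', ha, hb, hd, hE⟩
  have hx : x ∈ ({x, y, z} : Set (V → α)) := by simp
  have hy : y ∈ ({x, y, z} : Set (V → α)) := by simp
  have hz : z ∈ ({x, y, z} : Set (V → α)) := by simp
  obtain ⟨p, hp⟩ := hunc x hx y hy z hz a b d
  obtain ⟨q, hq⟩ := hunc x hx y hy z hz a b' d'
  obtain ⟨r, hr⟩ := hunc x hx y hy z hz a' b d'
  obtain ⟨s, hs⟩ := hunc x hx y hy z hz a' b' d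
  obtain ⟨w, hw1, hw2, hw3, hw4⟩ := hG.exists_adj₄ q r s p
  have hwE : ¬ FanoEdge x y z a a' b b' d d' w := by
    have h1 := hlink _ _ hw1
    have h2 := hlink _ _ hw2
    have h3 := hlink _ _ hw3
    have h4 := hlink _ _ hw4
    unfold FanoEdge
    grind
  refine hG.false_of_pure_commonNbrs hE ![q, p, p, p] ![r, r, q, q] ![s, s, s, r]
    ![fun w => x w = a ∨ y w = b ∨ z w = d, fun w => x w = a ∨ y w = b' ∨ z w = d',
      fun w => x w = a' ∨ y w = b ∨ z w = d', fun w => x w = a' ∨ y w = b' ∨ z w = d] ?_ ?_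
    ⟨0, w, hwE, hw1, hw2, hw3⟩
  · intro j u hu h1 h2 h3 v hv
    have h1 := hlink _ _ h1
    have h2 := hlink _ _ h2
    have h3 := hlink _ _ h3
    have h4 := hlink _ _ hv
    simp only [Set.mem_ofPred_eq, not_not, FanoEdge] at hu
    fin_cases j <;> simp at h1 h2 h3 ⊢ <;> grind
  · intro u hu
    simp only [Set.mem_ofPred_eq, FanoEdge] at hu
    by_contra! h
    have h0 := h 0
    have h1 := h 1
    have h2 := h 2
    have h3 := h 3
    simp at h0 h1 h2 h3
    grind

/-- For u, v with no shared label, every common neighbour takes one label from u and a different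
kind of label from v. More than 18 * L common neighbours in six pair classes put at least 3 * L into
one of them. -/
theorem Expands.structured [Finite V] [Nonempty V] (hG : Expands G L) (hJ : SetsJoined G L)
    (hV : 5 * L ≤ Nat.card V) (hlink : Linked G x y z) (hunc : Uncoverable {x, y, z}) :
    Structured L x y z := by
  have hcross := hJ.crossMeeting hlink
  obtain ⟨u⟩ := ‹Nonempty V›
  obtain ⟨v, hv⟩ := hunc x (by simp) y (by simp) z (by simp) (x u) (y u) (z u)
  have h1 := hG.lt_ncard_commonNbrs hV u v v
  have h2 := ncard_le_sum_of_forall_exists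
    (P := fun w => G.Adj u w ∧ G.Adj v w ∧ G.Adj v w)
    [fun w => x w = x u ∧ y w = y v, fun w => y w = y u ∧ x w = x v,
      fun w => x w = x u ∧ z w = z v, fun w => z w = z u ∧ x w = x v,
      fun w => y w = y u ∧ z w = z v, fun w => z w = z u ∧ y w = y v] (by
        rintro w ⟨h1, h2, -⟩
        have h1 := hlink _ _ h1
        have h2 := hlink _ _ h2
        simp only [List.mem_cons, List.not_mem_nil, or_false, exists_eq_or_imp, exists_eq_left]
        grind)
  simp only [List.map_cons, List.map_nil, List.sum_cons, List.sum_nil] at h2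
  by_contra hS
  have k1 : ¬ 3 * L ≤ {w | x w = x u ∧ y w = y v}.ncard :=
    fun h => hS (hcross.structured_of_large_pair h)
  have k2 : ¬ 3 * L ≤ {w | y w = y u ∧ x w = x v}.ncard :=
    fun h => hS (hcross.swap.structured_of_large_pair h).swap
  have k3 : ¬ 3 * L ≤ {w | x w = x u ∧ z w = z v}.ncard :=
    fun h => hS (hcross.rotate.rotate.swap.structured_of_large_pair h).swap.rotate
  have k4 : ¬ 3 * L ≤ {w | z w = z u ∧ x w = x v}.ncard :=
    fun h => hS (hcross.rotate.rotate.structured_of_large_pair h).rotate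
  have k5 : ¬ 3 * L ≤ {w | y w = y u ∧ z w = z v}.ncard :=
    fun h => hS (hcross.rotate.structured_of_large_pair h).rotate.rotate
  have k6 : ¬ 3 * L ≤ {w | z w = z u ∧ y w = y v}.ncard :=
    fun h => hS (hcross.rotate.swap.structured_of_large_pair h).swap.rotate.rotate
  omega

theorem Expands.not_uncoverable [Finite V] [Nonempty V] (hG : Expands G L) (hJ : SetsJoined G L)
    (hV : 5 * L ≤ Nat.card V) (hlink : Linked G x y z) : ¬ Uncoverable {x, y, z} := by
  intro hunc
  rcases hG.structured hJ hV hlink hunc with h | h | h | h | h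
  · exact hG.false_of_almostStar hV hlink hunc h
  · exact hG.false_of_almostStar hV hlink.rotate hunc.rotate h
  · exact hG.false_of_almostStar hV hlink.rotate.rotate hunc.rotate.rotate h
  · exact hG.false_of_almostTriangle hV hlink hunc h
  · exact hG.false_of_almostFano hlink hunc h

end Labels

/-! ### From label classes to monochromatic covers, and the obstructing colouring. -/

section TreeCover

variable {V : Type*} {G G' : SimpleGraph V}

theorem CoverableBy.mono {K : Type*} {c : G.EdgeLabeling K} {m m' : ℕ∞} (h : CoverableBy c m)
    (hm : m ≤ m') : CoverableBy c m' := by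
  obtain ⟨S, hS, hcov⟩ := h
  exact ⟨S, hS.trans hm, hcov⟩

theorem tc_le_natCast_iff {r m : ℕ} :
    tc r G ≤ m ↔ ∀ c : G.EdgeLabeling (Fin r), CoverableBy c m := by
  refine ⟨fun h c => ?_, fun h => sInf_le h⟩
  -- The infimum of the empty set is ⊤, so finiteness gives nonemptiness, and well-ordering makes
  -- the infimum attained.
  have hne : {m : ℕ∞ | ∀ c : G.EdgeLabeling (Fin r), CoverableBy c m}.Nonempty := by
    rw [Set.nonempty_iff_ne_empty]
    intro he
    simp [tc, he] at h
  exact (csInf_mem hne c).mono h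

theorem tc_mono {r m : ℕ} (hG : G ≤ G') (h : tc r G ≤ m) : tc r G' ≤ m := by
  rw [tc_le_natCast_iff] at h ⊢
  intro c
  obtain ⟨S, hS, hcov⟩ := h (c.pullback (SimpleGraph.Hom.ofLE hG))
  have hle : ∀ k, SimpleGraph.EdgeLabeling.labelGraph (c.pullback (SimpleGraph.Hom.ofLE hG)) k ≤
      c.labelGraph k := by
    intro k u v
    rw [SimpleGraph.EdgeLabeling.labelGraph_adj, SimpleGraph.EdgeLabeling.labelGraph_adj]
    rintro ⟨h1, h2⟩
    exact ⟨hG h1, h2⟩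
  let f : MonoComponent (c.pullback (SimpleGraph.Hom.ofLE hG)) → MonoComponent c :=
    fun A => ⟨A.1, A.2.map (SimpleGraph.Hom.ofLE (hle A.1))⟩
  refine ⟨f '' S, (Set.encard_image_le f S).trans hS, fun v => ?_⟩
  obtain ⟨A, hA, hv⟩ := hcov v
  refine ⟨f A, ⟨A, hA, rfl⟩, ?_⟩
  obtain ⟨k, A⟩ := A
  simp only [MonoComponent.verts, SimpleGraph.ConnectedComponent.mem_supp_iff] at hv ⊢
  subst hv
  rfl

/-- The monochromatic component of colour `k` that contains `v`. -/
def monoComponentMk {K : Type*} (c : G.EdgeLabeling K) (k : K) (v : V) : MonoComponent c :=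
  ⟨k, (c.labelGraph k).connectedComponentMk v⟩

theorem mem_verts_monoComponentMk {K : Type*} (c : G.EdgeLabeling K) (k : K) (v : V) :
    v ∈ (monoComponentMk c k v).verts :=
  rfl

theorem linked_monoComponentMk (c : G.EdgeLabeling (Fin 3)) :
    Linked G (monoComponentMk c 0) (monoComponentMk c 1) (monoComponentMk c 2) := by
  intro u v huv
  have key : ∀ k, c.get u v huv = k → monoComponentMk c k u = monoComponentMk c k v := by
    intro k hk
    have : (c.labelGraph k).Adj u v :=
      (SimpleGraph.EdgeLabeling.labelGraph_adj u v).2 ⟨huv, hk⟩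
    simp only [monoComponentMk, SimpleGraph.ConnectedComponent.sound this.reachable]
  generalize c.get u v huv = k at key
  fin_cases k
  · exact .inl (key 0 rfl)
  · exact .inr (.inl (key 1 rfl))
  · exact .inr (.inr (key 2 rfl))

theorem uncoverable_of_not_coverableBy {c : G.EdgeLabeling (Fin 3)} (h : ¬ CoverableBy c 3) :
    Uncoverable {monoComponentMk c 0, monoComponentMk c 1, monoComponentMk c 2} := by
  have hk : ∀ w ∈ ({monoComponentMk c 0, monoComponentMk c 1, monoComponentMk c 2} :
      Set (V → MonoComponent c)), ∀ v, v ∈ (w v).verts := by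
    rintro w (rfl | rfl | rfl) v <;> exact mem_verts_monoComponentMk _ _ _
  intro w₁ h₁ w₂ h₂ w₃ h₃ a b d
  by_contra! hcov
  refine h ⟨{a, b, d}, ?_, fun v => ?_⟩
  · refine (Set.encard_insert_le _ _).trans ?_
    refine (add_le_add_left (Set.encard_insert_le _ _) 1).trans ?_
    rw [Set.encard_singleton]
    norm_num
  · by_cases hv₁ : w₁ v = a
    · exact ⟨a, by simp, hv₁ ▸ hk _ h₁ v⟩
    · by_cases hv₂ : w₂ v = b
      · exact ⟨b, by simp, hv₂ ▸ hk _ h₂ v⟩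
      · exact ⟨d, by simp, hcov v hv₁ hv₂ ▸ hk _ h₃ v⟩

theorem tc_three_le_three_of_expands [Finite V] [Nonempty V] {L : ℕ} (hG : Expands G L)
    (hJ : SetsJoined G L) (hV : 5 * L ≤ Nat.card V) : tc 3 G ≤ 3 := by
  refine (tc_le_natCast_iff (m := 3)).2 fun c => ?_
  by_contra h
  exact hG.not_uncoverable hJ hV (linked_monoComponentMk c) (uncoverable_of_not_coverableBy h)

theorem mem_of_reachable_of_closed {H : SimpleGraph V} {C : Set V}
    (hC : ∀ u ∈ C, ∀ w, H.Adj u w → w ∈ C) {u w : V} (h : H.Reachable u w) (hu : u ∈ C) :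
    w ∈ C := by
  obtain ⟨p⟩ := h
  induction p with
  | nil => exact hu
  | cons hadj _ ih => exact ih (hC _ hu _ hadj)

/-- A colour different from `i` and `j`. -/
def avoidingColour (i j : Fin 3) : Fin 3 := if i = j then i + 1 else -(i + j)

theorem avoidingColour_comm (i j : Fin 3) : avoidingColour i j = avoidingColour j i := by
  revert i j
  decide

theorem avoidingColour_ne_left (i j : Fin 3) : avoidingColour i j ≠ i := by
  revert i j
  decide

/-- Edges at a, b, d get colours 0, 1, 2, so each of these is isolated in the other two colours. An
edge from e to u gets the index of one of a, b, d not adjacent to u, and every remaining edge avoids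
the indices of both ends. Each component of e is then a star that reaches none of a, b, d. -/
theorem four_le_tc_three_of_no_common_neighbour {a b d e : V}
    (hne : a ≠ b ∧ a ≠ d ∧ a ≠ e ∧ b ≠ d ∧ b ≠ e ∧ d ≠ e)
    (hind : ¬ G.Adj a b ∧ ¬ G.Adj a d ∧ ¬ G.Adj a e ∧ ¬ G.Adj b d ∧ ¬ G.Adj b e ∧ ¬ G.Adj d e)
    (hcn : ∀ u, G.Adj a u → G.Adj b u → G.Adj d u → ¬ G.Adj e u) : ¬ tc 3 G ≤ 3 := by
  classical
  let v : Fin 3 → V := ![a, b, d]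
  have hidx : ∀ u, ∃ i, G.Adj e u → ¬ G.Adj (v i) u := by
    intro u
    by_contra! h
    exact hcn u (h 0).2 (h 1).2 (h 2).2 (h 0).1
  choose idx hidx using hidx
  let col : V → V → Fin 3 := fun u w =>
    if u = a ∨ w = a then 0 else if u = b ∨ w = b then 1 else if u = d ∨ w = d then 2
    else if u = e then idx w else if w = e then idx u else avoidingColour (idx u) (idx w)
  have hcol : ∀ u w, col w u = col u w := by
    intro u w
    simp only [col, avoidingColour_comm (idx w) (idx u)]
    grind
  let c : G.EdgeLabeling (Fin 3) := .mk (fun u w _ => col u w) (fun u w _ => hcol u w)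
  have hadj : ∀ k u w, (c.labelGraph k).Adj u w → G.Adj u w ∧ col u w = k := by
    intro k u w h
    obtain ⟨h1, h2⟩ := (SimpleGraph.EdgeLabeling.labelGraph_adj u w).1 h
    exact ⟨h1, h2⟩
  have hiso : ∀ i k w, k ≠ i → (c.labelGraph k).Reachable (v i) w → w = v i := by
    intro i k w hki h
    refine mem_of_reachable_of_closed (C := {v i}) ?_ h rfl
    rintro u rfl w huw
    obtain ⟨h1, h2⟩ := hadj k _ _ huw
    exfalso
    have hab : ¬ G.Adj b a := fun h => hind.1 h.symm
    have had : ¬ G.Adj d a := fun h => hind.2.1 h.symm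
    have hbd : ¬ G.Adj d b := fun h => hind.2.2.2.1 h.symm
    have hwne : ∀ s, ¬ G.Adj (v i) s → w ≠ s := by rintro s hs rfl; exact hs h1
    have hwa := hwne a
    have hwb := hwne b
    have hwd := hwne d
    clear_value c
    clear hwne hidx hadj hcol hcn
    fin_cases i <;> simp [v, col] at h1 h2 hki hwa hwb hwd <;> grind
  have he : ∀ i k, ¬ (c.labelGraph k).Reachable e (v i) := by
    intro i k h
    -- This star is closed in colour k: an edge of colour `idx u` leaving a leaf u away from e could
    -- only go to `v (idx u)`, which is not adjacent to u.
    have hmem := mem_of_reachable_of_closed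
      (C := {u | u = e ∨ u ≠ a ∧ u ≠ b ∧ u ≠ d ∧ G.Adj e u ∧ idx u = k}) ?_ h (.inl rfl)
    · fin_cases i <;> simp [v] at hmem <;> grind
    rintro u hu w huw
    obtain ⟨h1, h2⟩ := hadj k _ _ huw
    rcases hu with rfl | ⟨hua, hub, hud, heu, rfl⟩
    · have hwa : w ≠ a := by rintro rfl; exact hind.2.2.1 h1.symm
      have hwb : w ≠ b := by rintro rfl; exact hind.2.2.2.2.1 h1.symm
      have hwd : w ≠ d := by rintro rfl; exact hind.2.2.2.2.2 h1.symm
      refine .inr ⟨hwa, hwb, hwd, h1, ?_⟩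
      simpa [col, hwa, hwb, hwd, hne.2.2.1.symm, hne.2.2.2.2.1.symm, hne.2.2.2.2.2.symm] using h2
    · left
      have hi := hidx u heu
      have hav := avoidingColour_ne_left (idx u) (idx w)
      have hue : u ≠ e := heu.ne'
      by_contra hwe
      simp only [col, hua, hub, hud, hue, hwe, false_or, if_false] at h2
      split_ifs at h2 with h3 h4 h5
      · subst h3
        rw [← h2] at hi
        exact hi h1.symm
      · subst h4
        rw [← h2] at hi
        exact hi h1.symm
      · subst h5
        rw [← h2] at hi
        exact hi h1.symm
      · exact hav h2
  have hv : ∀ i j k, i ≠ j → ¬ (c.labelGraph k).Reachable (v i) (v j) := by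
    intro i j k hij h
    have hvij : v i ≠ v j := by
      fin_cases i <;> fin_cases j <;> simp [v] at hij ⊢ <;> tauto
    by_cases hk : k = i
    · exact hvij (hiso j k _ (by rintro rfl; exact hij hk.symm) h.symm)
    · exact hvij (hiso i k _ hk h).symm
  rw [show (3 : ℕ∞) = ((3 : ℕ) : ℕ∞) from rfl, tc_le_natCast_iff]
  intro hcov
  obtain ⟨S, hS, hcov⟩ := hcov c
  let v' : Fin 4 → V := ![a, b, d, e]
  have hv' : ∀ i j k, i < j → ¬ (c.labelGraph k).Reachable (v' i) (v' j) := by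
    intro i j k hij h
    fin_cases i <;> fin_cases j <;> first | (simp at hij; done) | skip
    · exact hv 0 1 k (by decide) h
    · exact hv 0 2 k (by decide) h
    · exact he 0 k h.symm
    · exact hv 1 2 k (by decide) h
    · exact he 1 k h.symm
    · exact he 2 k h.symm
  choose A hAS hA using fun i => hcov (v' i)
  have hinj : Function.Injective A := by
    have : ∀ i j, i < j → A i ≠ A j := by
      intro i j hij h
      have h1 := hA i
      have h2 := hA j
      rw [h] at h1
      exact hv' i j (A j).1 hij (SimpleGraph.ConnectedComponent.exact (h1.trans h2.symm))
    intro i j h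
    by_contra hij
    rcases lt_or_gt_of_ne hij with h' | h'
    · exact this i j h' h
    · exact this j i h' h.symm
  have h4 : (Set.range A).encard = 4 := by
    rw [← Set.image_univ, hinj.encard_image, Set.encard_univ]
    simp
  have := (Set.encard_le_encard (Set.range_subset_iff.2 hAS)).trans hS
  rw [h4] at this
  exact absurd this (by decide)

end TreeCover

/-! ### Independence in the binomial random graph. -/

section RandomGraph

open MeasureTheory ProbabilityTheory unitInterval
open SimpleGraph (binomialRandom)

variable {V : Type*} {p : unitInterval}

instance [Finite V] : MeasurableSingletonClass (SimpleGraph V) where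
  measurableSet_singleton G := by
    have : ({G} : Set (SimpleGraph V)) = SimpleGraph.edgeSet ⁻¹' {G.edgeSet} := by
      ext H
      simp
    rw [this]
    exact SimpleGraph.measurable_edgeSet (measurableSet_singleton _)

theorem iIndepFun_mem_edgeSet [Finite V] (p : unitInterval) :
    iIndepFun (fun (e : Sym2 V) (G : SimpleGraph V) => e ∈ G.edgeSet) (binomialRandom V p) := by
  rw [SimpleGraph.binomialRandom_eq_map, setBernoulli_eq_map,
    Measure.map_map SimpleGraph.measurable_fromEdgeSet (by fun_prop)]
  have h := iIndepFun_infinitePi (ι := Sym2 V) (Ω := fun _ => Prop)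
    (P := fun e => toNNReal p • Measure.dirac (e ∈ (Sym2.diagSetᶜ : Set (Sym2 V))) +
      toNNReal (σ p) • Measure.dirac False)
    -- `fromEdgeSet` discards loops, so the coordinates of the product measure are cut accordingly.
    (X := fun e (q : Prop) => q ∧ ¬ e.IsDiag) (fun e => measurable_of_finite _)
  rw [iIndepFun_iff_measure_inter_preimage_eq_mul] at h ⊢
  intro S sets hS
  have hm : Measurable (SimpleGraph.fromEdgeSet ∘ fun (q : Sym2 V → Prop) => {i | q i}) :=
    SimpleGraph.measurable_fromEdgeSet.comp (by fun_prop)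
  rw [Measure.map_apply hm (Set.toFinite _).measurableSet]
  simp_rw [Measure.map_apply hm (Set.toFinite _).measurableSet]
  refine (congrArg _ ?_).trans ((h S hS).trans (Finset.prod_congr rfl fun e _ => congrArg _ ?_))
  · ext ω
    simp
  · ext ω
    simp

theorem binomialRandom_real_mem_edgeSet [Finite V] (p : unitInterval) {e : Sym2 V} (he : ¬ e.IsDiag) :
    (binomialRandom V p).real {G | e ∈ G.edgeSet} = p := by
  have hm : Measurable (SimpleGraph.fromEdgeSet ∘ fun (q : Sym2 V → Prop) => {i | q i}) :=
    SimpleGraph.measurable_fromEdgeSet.comp (by fun_prop)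
  rw [SimpleGraph.binomialRandom_eq_map, setBernoulli_eq_map,
    Measure.map_map SimpleGraph.measurable_fromEdgeSet (by fun_prop), measureReal_def,
    Measure.map_apply hm (Set.toFinite _).measurableSet]
  have : (SimpleGraph.fromEdgeSet ∘ fun (q : Sym2 V → Prop) => {i | q i}) ⁻¹'
      {G | e ∈ G.edgeSet} = (fun ω : Sym2 V → Prop => ω e) ⁻¹' {True} := by
    ext ω
    simp [he]
  rw [this, ← Measure.map_apply (by fun_prop) (measurableSet_singleton _),
    Measure.infinitePi_map_eval]
  simp [he]

/-- Membership in `B` is determined by the edges in `F`. -/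
def DependsOnEdges (B : Set (SimpleGraph V)) (F : Set (Sym2 V)) : Prop :=
  ∀ G H : SimpleGraph V, (∀ e ∈ F, e ∈ G.edgeSet ↔ e ∈ H.edgeSet) → G ∈ B → H ∈ B

theorem DependsOnEdges.compl {B : Set (SimpleGraph V)} {F : Set (Sym2 V)}
    (h : DependsOnEdges B F) : DependsOnEdges Bᶜ F :=
  fun G H hGH hG hH => hG (h H G (fun e he => (hGH e he).symm) hH)

/-- Each event is the preimage of its image under restriction to its edge set; restrictions to
disjoint edge sets are independent. -/
theorem DependsOnEdges.measureReal_inter [Finite V] {A B : Set (SimpleGraph V)} {E F : Set (Sym2 V)}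
    (hA : DependsOnEdges A E) (hB : DependsOnEdges B F) (hEF : Disjoint E F) (p : unitInterval) :
    (binomialRandom V p).real (A ∩ B) =
      (binomialRandom V p).real A * (binomialRandom V p).real B := by
  classical
  let r : (S : Finset (Sym2 V)) → SimpleGraph V → S → Prop := fun S G e => e.1 ∈ G.edgeSet
  have hr : ∀ (C : Set (SimpleGraph V)) (S : Set (Sym2 V)), DependsOnEdges C S →
      C = r S.toFinite.toFinset ⁻¹' (r S.toFinite.toFinset '' C) := by
    intro C S hC
    refine (Set.subset_preimage_image _ _).antisymm ?_
    rintro H ⟨G, hG, hGH⟩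
    refine hC G H (fun e he => ?_) hG
    exact (congrFun hGH ⟨e, S.toFinite.mem_toFinset.2 he⟩).to_iff
  have hind := (iIndepFun_mem_edgeSet (V := V) p).indepFun_finset E.toFinite.toFinset
    F.toFinite.toFinset (by simpa using hEF) (fun e => measurable_of_finite _)
  rw [indepFun_iff_measure_inter_preimage_eq_mul] at hind
  rw [hr A E hA, hr B F hB, measureReal_def, measureReal_def, measureReal_def,
    ← ENNReal.toReal_mul]
  exact congrArg _ (hind _ _ (Set.toFinite _).measurableSet (Set.toFinite _).measurableSet)

theorem DependsOnEdges.biInter {ι : Type*} {s : Finset ι} {B : ι → Set (SimpleGraph V)}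
    {F : ι → Set (Sym2 V)} (hB : ∀ i ∈ s, DependsOnEdges (B i) (F i)) :
    DependsOnEdges (⋂ i ∈ s, B i) (⋃ i ∈ s, F i) := by
  intro G H hGH hG
  simp only [Set.mem_iInter] at hG ⊢
  exact fun i hi => hB i hi G H
    (fun e he => hGH e (Set.mem_iUnion₂.2 ⟨i, hi, he⟩)) (hG i hi)

theorem measureReal_biInter_of_dependsOnEdges [Finite V] {ι : Type*} {s : Finset ι}
    {B : ι → Set (SimpleGraph V)} {F : ι → Set (Sym2 V)}
    (hB : ∀ i ∈ s, DependsOnEdges (B i) (F i))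
    (hF : (s : Set ι).PairwiseDisjoint F) (p : unitInterval) :
    (binomialRandom V p).real (⋂ i ∈ s, B i) = ∏ i ∈ s, (binomialRandom V p).real (B i) := by
  classical
  induction s using Finset.induction_on with
  | empty => simp
  | insert i s hi ih =>
    rw [Finset.set_biInter_insert, Finset.prod_insert hi]
    have hB' : ∀ j ∈ s, DependsOnEdges (B j) (F j) :=
      fun j hj => hB j (Finset.mem_insert_of_mem hj)
    have hd : Disjoint (F i) (⋃ j ∈ s, F j) := by
      refine Set.disjoint_iUnion₂_right.2 fun j hj => ?_
      exact hF (by simp) (by simp [hj]) (by rintro rfl; exact hi hj)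
    rw [(hB i (Finset.mem_insert_self i s)).measureReal_inter (DependsOnEdges.biInter hB') hd,
      ih hB' (hF.subset (by simp))]

theorem dependsOnEdges_mem_edgeSet (e : Sym2 V) :
    DependsOnEdges {G : SimpleGraph V | e ∈ G.edgeSet} {e} :=
  fun _ _ hGH hG => (hGH e rfl).1 hG

theorem measureReal_subset_edgeSet [Finite V] (p : unitInterval) {F : Finset (Sym2 V)}
    (hF : ∀ e ∈ F, ¬ e.IsDiag) :
    (binomialRandom V p).real {G | ∀ e ∈ F, e ∈ G.edgeSet} = (p : ℝ) ^ F.card := by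
  have := measureReal_biInter_of_dependsOnEdges (s := F)
    (fun e _ => dependsOnEdges_mem_edgeSet e) (fun e _ f _ hef => by simpa using hef) p
  rw [Finset.prod_congr rfl fun e he => binomialRandom_real_mem_edgeSet p (hF e he),
    Finset.prod_const] at this
  rw [← this]
  congr 1
  ext
  simp

theorem measureReal_disjoint_edgeSet [Finite V] (p : unitInterval) {F : Finset (Sym2 V)}
    (hF : ∀ e ∈ F, ¬ e.IsDiag) :
    (binomialRandom V p).real {G | ∀ e ∈ F, e ∉ G.edgeSet} = (1 - p : ℝ) ^ F.card := by
  have := measureReal_biInter_of_dependsOnEdges (s := F)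
    (fun e _ => (dependsOnEdges_mem_edgeSet e).compl) (fun e _ f _ hef => by simpa using hef) p
  rw [Finset.prod_congr rfl fun e he => by
    rw [probReal_compl_eq_one_sub (Set.toFinite _).measurableSet,
      binomialRandom_real_mem_edgeSet p (hF e he)], Finset.prod_const] at this
  rw [← this]
  congr 1
  ext
  simp

/-- A lower tail bound for the number of independent events that occur. -/
theorem measureReal_ncard_le_of_dependsOnEdges [Finite V] {ι : Type*} {s : Finset ι}
    {B : ι → Set (SimpleGraph V)} {F : ι → Set (Sym2 V)}
    (hB : ∀ i ∈ s, DependsOnEdges (B i) (F i)) (hF : (s : Set ι).PairwiseDisjoint F)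
    {q m : ℝ} (hq : ∀ i ∈ s, q ≤ (binomialRandom V p).real (B i)) :
    (binomialRandom V p).real {G | ({i | i ∈ s ∧ G ∈ B i}.ncard : ℝ) ≤ m} ≤
      Real.exp (m - s.card * q / 2) := by
  classical
  let X : s → SimpleGraph V → ℝ := fun i => (B i).indicator 1
  have hind : iIndepFun X (binomialRandom V p) := by
    rw [iIndepFun_iff_measure_inter_preimage_eq_mul]
    intro S sets _
    have hdep : ∀ i ∈ S, DependsOnEdges (X i ⁻¹' sets i) (F i) := by
      intro i _ G H hGH hG
      have : X i G = X i H := by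
        have hiff : G ∈ B i ↔ H ∈ B i :=
          ⟨hB i i.2 G H hGH, hB i i.2 H G fun e he => (hGH e he).symm⟩
        simp only [X, Set.indicator, hiff, Pi.one_apply]
      simpa [this] using hG
    have := measureReal_biInter_of_dependsOnEdges hdep
      (fun i _ j _ hij => hF i.2 j.2 fun h => hij (Subtype.ext h)) p
    refine (ENNReal.toReal_eq_toReal_iff' (measure_ne_top _ _)
      (ENNReal.prod_ne_top fun i _ => measure_ne_top _ _)).1 ?_
    rw [ENNReal.toReal_prod]
    exact this
  -- Chernoff bound with exponent -1: since exp(-1) ≤ 1/2, each factor is at most 1 - q/2 ≤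
  -- exp(-q/2).
  have hmgf : ∀ i : s, mgf (X i) (binomialRandom V p) (-1) ≤ Real.exp (-(q / 2)) := by
    intro i
    have h1 : (fun G => Real.exp (-1 * X i G)) =
        fun G => 1 - (B i).indicator (fun _ => 1 - Real.exp (-1)) G := by
      ext G
      by_cases hG : G ∈ B i <;> simp [X, hG]
    have h2 : mgf (X i) (binomialRandom V p) (-1) =
        1 - (binomialRandom V p).real (B i) * (1 - Real.exp (-1)) := by
      rw [mgf, h1, integral_sub (integrable_const _)
        ((integrable_const _).indicator (Set.toFinite _).measurableSet),
        integral_indicator_const _ (Set.toFinite _).measurableSet]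
      simp
    have h3 : Real.exp (-1) ≤ 1 / 2 := by
      rw [Real.exp_neg, one_div]
      exact inv_anti₀ (by norm_num) (by linarith [Real.add_one_le_exp (1 : ℝ)])
    have h4 := hq i i.2
    have h5 : 0 ≤ (binomialRandom V p).real (B i) := measureReal_nonneg
    rw [h2]
    refine le_trans ?_ (Real.add_one_le_exp _)
    nlinarith
  have hcard : ∀ G, (∑ i, X i) G = ({i | i ∈ s ∧ G ∈ B i}.ncard : ℝ) := by
    intro G
    have : {i | i ∈ s ∧ G ∈ B i} = ((s.filter fun i => G ∈ B i : Finset ι) : Set ι) := by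
      ext
      simp
    rw [this, Set.ncard_coe_finset, Finset.sum_apply, Finset.card_filter]
    push_cast
    refine Eq.trans (Finset.sum_congr rfl fun i _ => ?_)
      (Finset.sum_coe_sort s fun i => if G ∈ B i then (1 : ℝ) else 0)
    simp [X, Set.indicator]
  have h := measure_le_le_exp_mul_mgf (X := ∑ i, X i) (μ := binomialRandom V p) (t := -1) m
    (by norm_num) (.of_finite)
  simp only [hcard] at h
  refine h.trans ?_
  rw [hind.mgf_sum (fun i => measurable_of_finite _)]
  refine (mul_le_mul_of_nonneg_left (Finset.prod_le_prod (fun i _ => mgf_nonneg)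
    fun i _ => hmgf i) (Real.exp_pos _).le).trans ?_
  rw [Finset.prod_const, ← Real.exp_nat_mul, ← Real.exp_add]
  simp only [Finset.card_univ, Fintype.card_coe]
  refine Real.exp_le_exp.2 (le_of_eq ?_)
  ring

end RandomGraph

/-! ### Probability estimates for joined sets and common neighbourhoods. -/

section UpperBound

open MeasureTheory ProbabilityTheory
open SimpleGraph (binomialRandom)

variable {V : Type*}

/-- All pairs between a vertex `u` and the vertices of `S`. -/
def starEdges (S : Set V) (u : V) : Set (Sym2 V) :=
  (fun w => s(w, u)) '' S

theorem disjoint_starEdges {S : Set V} {u v : V} (hv : v ∉ S) (huv : u ≠ v) :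
    Disjoint (starEdges S u) (starEdges S v) := by
  rw [Set.disjoint_left]
  rintro _ ⟨w, hw, rfl⟩ ⟨w', hw', h⟩
  rcases Sym2.eq_iff.1 h with ⟨-, h⟩ | ⟨-, h⟩
  · exact huv h.symm
  · exact hv (h ▸ hw)

theorem dependsOnEdges_of_adj {u : V} {S : Set V} {B : Set (SimpleGraph V)}
    (h : ∀ G H : SimpleGraph V, (∀ w ∈ S, G.Adj w u ↔ H.Adj w u) → G ∈ B → H ∈ B) :
    DependsOnEdges B (starEdges S u) := by
  intro G H hGH
  refine h G H fun w hw => ?_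
  have := hGH s(w, u) ⟨w, hw, rfl⟩
  simpa using this

theorem dependsOnEdges_forall_adj (S : Finset V) (u : V) :
    DependsOnEdges {G : SimpleGraph V | ∀ w ∈ S, G.Adj w u} (starEdges (S : Set V) u) :=
  dependsOnEdges_of_adj fun _ _ h hG w hw => (h w hw).1 (hG w hw)

theorem dependsOnEdges_forall_not_adj (S : Finset V) (u : V) :
    DependsOnEdges {G : SimpleGraph V | ∀ w ∈ S, ¬ G.Adj w u} (starEdges (S : Set V) u) :=
  dependsOnEdges_of_adj fun _ _ h hG w hw hadj => hG w hw ((h w hw).2 hadj)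

theorem measureReal_forall_adj [Finite V] (p : unitInterval) {S : Finset V} {u : V} (hu : u ∉ S) :
    (binomialRandom V p).real {G | ∀ w ∈ S, G.Adj w u} = (p : ℝ) ^ S.card := by
  classical
  have h := measureReal_subset_edgeSet p (F := S.image fun w => s(w, u)) (by
    simp only [Finset.mem_image, forall_exists_index, and_imp, forall_apply_eq_imp_iff₂,
      Sym2.mk_isDiag_iff]
    rintro w hw rfl
    exact hu hw)
  rw [Finset.card_image_of_injective _ fun w w' hww => Sym2.congr_left.1 hww] at h
  simpa using h

theorem measureReal_forall_not_adj [Finite V] (p : unitInterval) {S : Finset V} {u : V}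
    (hu : u ∉ S) :
    (binomialRandom V p).real {G | ∀ w ∈ S, ¬ G.Adj w u} = (1 - p : ℝ) ^ S.card := by
  classical
  have h := measureReal_disjoint_edgeSet p (F := S.image fun w => s(w, u)) (by
    simp only [Finset.mem_image, forall_exists_index, and_imp, forall_apply_eq_imp_iff₂,
      Sym2.mk_isDiag_iff]
    rintro w hw rfl
    exact hu hw)
  rw [Finset.card_image_of_injective _ fun w w' hww => Sym2.congr_left.1 hww] at h
  simpa using h

theorem measureReal_not_setsJoined_le [Finite V] (p : unitInterval) (L : ℕ) :
    (binomialRandom V p).real {G | ¬ SetsJoined G L} ≤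
      (Nat.card V : ℝ) ^ (2 * L) * (1 - p : ℝ) ^ (L ^ 2) := by
  classical
  have := Fintype.ofFinite V
  let I : Finset (Finset V × Finset V) :=
    ((Finset.univ.powersetCard L) ×ˢ (Finset.univ.powersetCard L)).filter fun q => Disjoint q.1 q.2
  have hsub : {G : SimpleGraph V | ¬ SetsJoined G L} ⊆
      ⋃ q ∈ I, {G | ∀ e ∈ (q.1 ×ˢ q.2).image fun a => s(a.1, a.2), e ∉ G.edgeSet} := by
    intro G hG
    simp only [Set.mem_ofPred_eq, SetsJoined] at hG
    push Not at hG
    obtain ⟨A, B, hAB, hA, hB, h⟩ := hG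
    rw [Set.ncard_eq_toFinset_card'] at hA hB
    obtain ⟨A', hA', hcA⟩ := Finset.exists_subset_card_eq hA
    obtain ⟨B', hB', hcB⟩ := Finset.exists_subset_card_eq hB
    refine Set.mem_iUnion₂.2 ⟨(A', B'), ?_, ?_⟩
    · simp only [I, Finset.mem_filter, Finset.mem_product, Finset.mem_powersetCard,
        Finset.subset_univ, true_and]
      exact ⟨⟨hcA, hcB⟩, Finset.disjoint_of_subset_left hA'
        (Finset.disjoint_of_subset_right hB' (Set.disjoint_toFinset.2 hAB))⟩
    · simp only [Set.mem_ofPred_eq, Finset.mem_image, forall_exists_index, and_imp]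
      rintro _ ⟨a, b⟩ hab rfl
      rw [Finset.mem_product] at hab
      exact h a (Set.mem_toFinset.1 (hA' hab.1)) b (Set.mem_toFinset.1 (hB' hab.2))
  refine (measureReal_mono hsub (measure_ne_top _ _)).trans ((measureReal_biUnion_finset_le _ _).trans ?_)
  have hterm : ∀ q ∈ I, (binomialRandom V p).real
      {G | ∀ e ∈ (q.1 ×ˢ q.2).image fun a => s(a.1, a.2), e ∉ G.edgeSet} =
        (1 - p : ℝ) ^ (L ^ 2) := by
    rintro ⟨A, B⟩ hq
    simp only [I, Finset.mem_filter, Finset.mem_product, Finset.mem_powersetCard,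
      Finset.subset_univ, true_and] at hq
    obtain ⟨⟨hA, hB⟩, hAB⟩ := hq
    rw [measureReal_disjoint_edgeSet]
    · rw [Finset.card_image_of_injOn, Finset.card_product, hA, hB, sq]
      rintro ⟨a, b⟩ hab ⟨a', b'⟩ hab' h
      simp only [Finset.coe_product, Set.mem_prod, Finset.mem_coe] at hab hab'
      rcases Sym2.eq_iff.1 h with ⟨rfl, rfl⟩ | ⟨rfl, rfl⟩
      · rfl
      · exact absurd hab.1 (Finset.disjoint_right.1 hAB hab'.2)
    · simp only [Finset.mem_image, Finset.mem_product]
      rintro _ ⟨⟨a, b⟩, ⟨ha, hb⟩, rfl⟩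
      rw [Sym2.mk_isDiag_iff]
      rintro (h : a = b)
      exact Finset.disjoint_left.1 hAB ha (h ▸ hb)
  rw [Finset.sum_congr rfl hterm, Finset.sum_const, nsmul_eq_mul]
  refine mul_le_mul_of_nonneg_right ?_ (pow_nonneg (sub_nonneg.2 p.2.2) _)
  have hI : I.card ≤ Fintype.card V ^ (2 * L) := by
    refine (Finset.card_filter_le _ _).trans ?_
    rw [Finset.card_product, Finset.card_powersetCard, two_mul, pow_add]
    exact Nat.mul_le_mul (Nat.choose_le_pow _ _) (Nat.choose_le_pow _ _)
  rw [Nat.card_eq_fintype_card]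
  exact_mod_cast hI

theorem exp_neg_le_one_sub_half {x : ℝ} (h0 : 0 ≤ x) (h1 : x ≤ 1) :
    Real.exp (-x) ≤ 1 - x / 2 := by
  rw [Real.exp_neg]
  have h := Real.add_one_le_exp x
  refine (inv_anti₀ (by linarith) h).trans ?_
  rw [inv_le_iff_one_le_mul₀ (by linarith)]
  nlinarith

/-- For disjoint `T` and `D` the two conditions are independent, and p|D| ≤ 1 keeps the chance of a
neighbour in `D` at least p|D|/2. If they overlap, the second condition follows from the first. -/
theorem le_measureReal_adj_and_exists_adj [Finite V] [DecidableEq V] (p : unitInterval)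
    {T D : Finset V} (hT : T.card ≤ 3) {u : V} (hu : u ∉ T ∪ D) (hD : (p : ℝ) * D.card ≤ 1) :
    (p : ℝ) ^ 4 * D.card / 2 ≤
      (binomialRandom V p).real {G | (∀ w ∈ T, G.Adj w u) ∧ ∃ w ∈ D, G.Adj w u} := by
  have hp0 : (0 : ℝ) ≤ p := p.2.1
  have hp1 : (p : ℝ) ≤ 1 := p.2.2
  rw [Finset.mem_union, not_or] at hu
  have hpT : (p : ℝ) ^ 3 ≤ (p : ℝ) ^ T.card := pow_le_pow_of_le_one hp0 hp1 hT
  have hp3 : (0 : ℝ) ≤ (p : ℝ) ^ 3 := pow_nonneg hp0 3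
  by_cases hTD : Disjoint T D
  · have h : {G : SimpleGraph V | (∀ w ∈ T, G.Adj w u) ∧ ∃ w ∈ D, G.Adj w u} =
        {G | ∀ w ∈ T, G.Adj w u} ∩ {G | ∀ w ∈ D, ¬ G.Adj w u}ᶜ := by
      ext G
      simp
    have hd : Disjoint (starEdges (T : Set V) u) (starEdges (D : Set V) u) := by
      rw [Set.disjoint_left]
      rintro _ ⟨w, hw, rfl⟩ ⟨w', hw', h⟩
      have : w' = w := Sym2.congr_left.1 h
      subst this
      exact Finset.disjoint_left.1 hTD hw hw'
    rw [h, (dependsOnEdges_forall_adj T u).measureReal_inter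
      (dependsOnEdges_forall_not_adj D u).compl hd,
      probReal_compl_eq_one_sub (Set.toFinite _).measurableSet]
    have h1 := measureReal_forall_adj p hu.1
    have h2 := measureReal_forall_not_adj p hu.2
    rw [h1, h2]
    have h3 : (1 - p : ℝ) ^ D.card ≤ 1 - p * D.card / 2 := by
      refine le_trans ?_ (exp_neg_le_one_sub_half (mul_nonneg hp0 (Nat.cast_nonneg _)) hD)
      rw [show -((p : ℝ) * D.card) = D.card * (-p) by ring, Real.exp_nat_mul]
      exact pow_le_pow_left₀ (by linarith) (Real.one_sub_le_exp_neg _) _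
    have h4 : (0 : ℝ) ≤ p * D.card / 2 := by positivity
    calc (p : ℝ) ^ 4 * D.card / 2 = (p : ℝ) ^ 3 * (p * D.card / 2) := by ring
      _ ≤ (p : ℝ) ^ T.card * (1 - (1 - p : ℝ) ^ D.card) :=
        mul_le_mul hpT (by linarith) h4 (pow_nonneg hp0 _)
  · obtain ⟨w, hwT, hwD⟩ := Finset.not_disjoint_iff.1 hTD
    have h : {G : SimpleGraph V | (∀ w ∈ T, G.Adj w u) ∧ ∃ w ∈ D, G.Adj w u} =
        {G | ∀ w ∈ T, G.Adj w u} := by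
      ext G
      exact ⟨fun h => h.1, fun h => ⟨h, w, hwD, h w hwT⟩⟩
    rw [h, measureReal_forall_adj p hu.1]
    refine le_trans ?_ hpT
    have : (p : ℝ) ^ 4 * D.card / 2 = (p : ℝ) ^ 3 * (p * D.card) / 2 := by ring
    rw [this]
    nlinarith

theorem measureReal_few_commonNbrs_le [Finite V] [DecidableEq V] (p : unitInterval) {T D : Finset V}
    (hT : T.card ≤ 3) (hD : (p : ℝ) * D.card ≤ 1) (hV : 2 * (D.card + 3) ≤ Nat.card V) (m : ℝ) :
    (binomialRandom V p).real
      {G | ({u | (∀ w ∈ T, G.Adj w u) ∧ ∃ w ∈ D, G.Adj w u}.ncard : ℝ) ≤ m} ≤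
        Real.exp (m - Nat.card V * p ^ 4 * D.card / 8) := by
  have := Fintype.ofFinite V
  have hp0 : (0 : ℝ) ≤ p := p.2.1
  -- Vertices outside `T ∪ D` have disjoint stars to it, hence independent events, and they make up
  -- at least half of all vertices.
  let s : Finset V := (T ∪ D)ᶜ
  have h := measureReal_ncard_le_of_dependsOnEdges (p := p) (s := s)
    (B := fun u => {G : SimpleGraph V | (∀ w ∈ T, G.Adj w u) ∧ ∃ w ∈ D, G.Adj w u})
    (F := fun u => starEdges (T ∪ D : Set V) u) (fun u _ => dependsOnEdges_of_adj (by
      rintro G H hGH ⟨h1, w, hw, h2⟩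
      exact ⟨fun w hw => (hGH w (.inl hw)).1 (h1 w hw), w, hw, (hGH w (.inr hw)).1 h2⟩))
    (fun u _ v hv huv => disjoint_starEdges (by simpa [s] using hv) huv)
    (q := (p : ℝ) ^ 4 * D.card / 2) (m := m)
    (fun u hu => le_measureReal_adj_and_exists_adj p hT (by simpa only [s, Finset.mem_compl] using hu) hD)
  refine (measureReal_mono ?_).trans (h.trans ?_)
  · intro G (hG : _ ≤ m)
    refine le_trans (Nat.cast_le.2 (Set.ncard_le_ncard ?_ (Set.toFinite _))) hG
    exact fun u hu => hu.2
  · refine Real.exp_le_exp.2 ?_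
    have hs : Nat.card V ≤ 2 * s.card := by
      have h1 := Finset.card_union_le T D
      have h2 := Finset.card_compl (T ∪ D)
      have h3 : Nat.card V = Fintype.card V := Nat.card_eq_fintype_card
      simp only [s]
      omega
    have hs' : (Nat.card V : ℝ) ≤ 2 * s.card := by exact_mod_cast hs
    have : 0 ≤ (p : ℝ) ^ 4 * D.card := by positivity
    nlinarith

end UpperBound

/-! ### Choice of parameters above the threshold. -/

section UpperBoundAssembly

open MeasureTheory ProbabilityTheory
open SimpleGraph (binomialRandom)

variable {V : Type*}

/-- A set larger than `d₀` contains one of size `d₀`, which already reaches the cap 18 * L; only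
sets of size at most `d₀` need a union bound. -/
theorem expands_of_forall_lt_ncard [Finite V] [DecidableEq V] {G : SimpleGraph V} {L d₀ : ℕ} {K : ℝ}
    (hK : 4 ≤ K) (hL : 18 * L ≤ K * d₀) (hd₀ : 0 < d₀)
    (h : ∀ a b d : V, ∀ D : Finset V, D.Nonempty → D.card ≤ d₀ → K * D.card <
      {u | (∀ w ∈ ({a, b, d} : Finset V), G.Adj w u) ∧ ∃ w ∈ D, G.Adj w u}.ncard) :
    Expands G L := by
  have := Fintype.ofFinite V
  intro a b d D hD
  have key : ∀ D' : Finset V, (D' : Set V) ⊆ D → D'.Nonempty → D'.card ≤ d₀ → K * D'.card <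
      {u | (G.Adj a u ∧ G.Adj b u ∧ G.Adj d u) ∧ ∃ w ∈ D, G.Adj w u}.ncard := by
    intro D' hsub hne hcard
    refine (h a b d D' hne hcard).trans_le
      (Nat.cast_le.2 (Set.ncard_le_ncard ?_ (Set.toFinite _)))
    rintro u ⟨hu, w, hw, hwu⟩
    simp only [Finset.mem_insert, Finset.mem_singleton, forall_eq_or_imp, forall_eq] at hu
    exact ⟨hu, w, hsub hw, hwu⟩
  rcases le_or_gt D.ncard d₀ with hcard | hcard
  · have h1 := key D.toFinite.toFinset (by simp) (by simpa using hD)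
      (by rwa [← Set.ncard_eq_toFinset_card])
    rw [← Set.ncard_eq_toFinset_card] at h1
    refine (min_le_left _ _).trans_lt ?_
    have h2 : (4 * D.ncard : ℝ) ≤ K * D.ncard := mul_le_mul_of_nonneg_right hK (Nat.cast_nonneg _)
    exact_mod_cast h2.trans_lt h1
  · rw [Set.ncard_eq_toFinset_card _ D.toFinite] at hcard
    obtain ⟨D', hsub, hD'⟩ := Finset.exists_subset_card_eq hcard.le
    have h1 := key D' (fun w hw => D.toFinite.mem_toFinset.1 (hsub hw))
      (Finset.card_pos.1 (by omega)) hD'.le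
    rw [hD'] at h1
    refine (min_le_right _ _).trans_lt ?_
    exact_mod_cast hL.trans_lt h1

theorem measureReal_not_expands_le [Finite V] (p : unitInterval) {L d₀ : ℕ} {K : ℝ}
    (hK : 4 ≤ K) (hL : 18 * L ≤ K * d₀) (hd₀ : 0 < d₀) (hp : (p : ℝ) * d₀ ≤ 1)
    (hV : 2 * (d₀ + 3) ≤ Nat.card V) :
    (binomialRandom V p).real {G | ¬ Expands G L} ≤
      ∑ d ∈ Finset.Icc 1 d₀, (Nat.card V : ℝ) ^ (3 + d) *
        Real.exp (K * d - Nat.card V * p ^ 4 * d / 8) := by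
  classical
  have := Fintype.ofFinite V
  let B : V × V × V → Finset V → Set (SimpleGraph V) := fun t D =>
    {G | ({u | (∀ w ∈ ({t.1, t.2.1, t.2.2} : Finset V), G.Adj w u) ∧
      ∃ w ∈ D, G.Adj w u}.ncard : ℝ) ≤ K * D.card}
  have hsub : {G : SimpleGraph V | ¬ Expands G L} ⊆ ⋃ d ∈ Finset.Icc 1 d₀,
      ⋃ q ∈ (Finset.univ : Finset (V × V × V)) ×ˢ Finset.univ.powersetCard d, B q.1 q.2 := by
    intro G hG
    by_contra hG'
    refine hG (expands_of_forall_lt_ncard hK hL hd₀ fun a b d D hD hcard => ?_)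
    by_contra! hlt
    refine hG' (Set.mem_iUnion₂.2 ⟨D.card, Finset.mem_Icc.2 ⟨hD.card_pos, hcard⟩,
      Set.mem_iUnion₂.2 ⟨((a, b, d), D), by simp, hlt⟩⟩)
  refine (measureReal_mono hsub (measure_ne_top _ _)).trans
    ((measureReal_biUnion_finset_le _ _).trans (Finset.sum_le_sum fun d hd => ?_))
  rw [Finset.mem_Icc] at hd
  refine (measureReal_biUnion_finset_le _ _).trans ?_
  have hterm : ∀ q ∈ (Finset.univ : Finset (V × V × V)) ×ˢ Finset.univ.powersetCard d,
      (binomialRandom V p).real (B q.1 q.2) ≤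
        Real.exp (K * d - Nat.card V * p ^ 4 * d / 8) := by
    rintro ⟨⟨a, b, c⟩, D⟩ hq
    simp only [Finset.mem_product, Finset.mem_univ, true_and, Finset.mem_powersetCard,
      Finset.subset_univ] at hq
    subst hq
    refine measureReal_few_commonNbrs_le p Finset.card_le_three ?_ (by dsimp only; omega) _
    refine le_trans (mul_le_mul_of_nonneg_left ?_ p.2.1) hp
    exact_mod_cast hd.2
  refine (Finset.sum_le_card_nsmul _ _ _ hterm).trans ?_
  rw [nsmul_eq_mul]
  refine mul_le_mul_of_nonneg_right ?_ (Real.exp_pos _).le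
  have hcard : ((Finset.univ : Finset (V × V × V)) ×ˢ
      (Finset.univ : Finset V).powersetCard d).card ≤ Nat.card V ^ (3 + d) := by
    rw [Finset.card_product, Finset.card_powersetCard, Finset.card_univ, Finset.card_univ,
      Fintype.card_prod, Fintype.card_prod, Nat.card_eq_fintype_card, pow_add]
    exact Nat.mul_le_mul (by ring_nf; rfl) (Nat.choose_le_pow _ _)
  exact_mod_cast hcard

theorem measureReal_not_tc_three_le_three_le [Finite V] (p : unitInterval)
    (hlog : 1 ≤ Real.log (Nat.card V))
    (hp : 1296 * Real.log (Nat.card V) ≤ Nat.card V * (p : ℝ) ^ 4) :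
    (binomialRandom V p).real {G | ¬ tc 3 G ≤ 3} ≤ 2 / Nat.card V := by
  set n := Nat.card V with hn
  set l := Real.log n with hl
  have hp0 : (0 : ℝ) ≤ p := p.2.1
  have hp1 : (p : ℝ) ≤ 1 := p.2.2
  have hn0 : 0 < n := by
    rw [Nat.pos_iff_ne_zero]
    intro h
    rw [hl, h] at hlog
    norm_num at hlog
  have hn0' : (0 : ℝ) < n := Nat.cast_pos.2 hn0
  have hexp : Real.exp l = n := Real.exp_log hn0'
  have hp' : (0 : ℝ) < p := by
    rcases hp0.lt_or_eq with h | h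
    · exact h
    · rw [← h] at hp
      norm_num at hp
      linarith
  have hpn : 1296 * l / p ≤ n := by
    rw [div_le_iff₀ hp']
    have : (p : ℝ) ^ 4 ≤ p := pow_le_of_le_one hp0 hp1 (by norm_num)
    nlinarith
  have hlp : 1 ≤ 1 / (p : ℝ) := by rwa [one_le_div hp']
  have hlp' : 1 / (p : ℝ) ≤ l / p := div_le_div_of_nonneg_right hlog hp0
  -- The largest size with p * d₀ ≤ 1, as the estimate for a neighbour in D requires.
  set d₀ := ⌊1 / (p : ℝ)⌋₊ with hd
  have hd0 : 0 < d₀ := Nat.floor_pos.2 hlp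
  have hdp : (d₀ : ℝ) ≤ 1 / p := Nat.floor_le (by linarith)
  have hdp' : 1 / (p : ℝ) < d₀ + 1 := Nat.lt_floor_add_one _
  have hd1 : (1 : ℝ) ≤ d₀ := by exact_mod_cast hd0
  -- With L p ≥ 3l, the non-edge probability exp(-p L²) beats the n^(2L) pairs of sets by exp(-L l).
  set L := ⌈3 * l / p⌉₊ with hL
  have hL1 : 3 * l / p ≤ L := Nat.le_ceil _
  have hL2 : (L : ℝ) < 3 * l / p + 1 := Nat.ceil_lt_add_one (by positivity)
  have e1 : 3 * l / p = 3 * (l / p) := by ring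
  have e2 : 1296 * l / p = 1296 * (l / p) := by ring
  have e3 : l / p = l * (1 / p) := by ring
  have hLd : 18 * (L : ℝ) ≤ 150 * l * d₀ := by
    have : l * (1 / p) ≤ l * (2 * d₀) := mul_le_mul_of_nonneg_left (by linarith) (by linarith)
    nlinarith
  have hLV : 5 * L ≤ Nat.card V := by
    have : (5 * L : ℝ) ≤ n := by linarith
    exact_mod_cast this
  have hdV : 2 * (d₀ + 3) ≤ Nat.card V := by
    have : (2 * (d₀ + 3) : ℝ) ≤ n := by linarith
    exact_mod_cast this
  have hne : Nonempty V := (Nat.card_pos_iff.1 hn0).1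
  have hsub : {G : SimpleGraph V | ¬ tc 3 G ≤ 3} ⊆
      {G | ¬ SetsJoined G L} ∪ {G | ¬ Expands G L} := by
    intro G hG
    by_contra h
    simp only [Set.mem_union, Set.mem_ofPred_eq, not_or, not_not] at h
    exact hG (tc_three_le_three_of_expands h.2 h.1 hLV)
  have hjoin : (binomialRandom V p).real {G | ¬ SetsJoined G L} ≤ 1 / n := by
    refine (measureReal_not_setsJoined_le p L).trans ?_
    rw [← hn, ← hexp, ← Real.exp_nat_mul, one_div, ← Real.exp_neg]
    have h1 : (1 - p : ℝ) ^ (L ^ 2) ≤ Real.exp ((L ^ 2 : ℕ) * (-p)) := by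
      rw [Real.exp_nat_mul]
      exact pow_le_pow_left₀ (by linarith) (Real.one_sub_le_exp_neg _) _
    refine (mul_le_mul_of_nonneg_left h1 (Real.exp_pos _).le).trans ?_
    rw [← Real.exp_add]
    refine Real.exp_le_exp.2 ?_
    push_cast
    have h2 : 3 * l ≤ L * p := by rwa [div_le_iff₀ hp'] at hL1
    have h3 : (1 : ℝ) ≤ L := by linarith
    nlinarith
  have hexpands : (binomialRandom V p).real {G | ¬ Expands G L} ≤ 1 / n := by
    -- The factor 150 covers 18 * L ≤ 144 * l * d₀. Since 1296 / 8 = 162, the exponent of each term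
    -- is at most (3 + d) l + 150 l d - 162 l d ≤ -2 l.
    refine (measureReal_not_expands_le p (K := 150 * l) (by linarith) hLd hd0
      (by rw [mul_comm]; rwa [le_div_iff₀ hp'] at hdp) hdV).trans ?_
    have hterm : ∀ d ∈ Finset.Icc 1 d₀, (Nat.card V : ℝ) ^ (3 + d) *
        Real.exp (150 * l * d - Nat.card V * p ^ 4 * d / 8) ≤ 1 / n * (1 / n) := by
      intro d hd
      have hd' : (1 : ℝ) ≤ d := by exact_mod_cast (Finset.mem_Icc.1 hd).1
      rw [← hn, ← hexp, ← Real.exp_nat_mul, one_div, ← Real.exp_neg, ← Real.exp_add,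
        ← Real.exp_add, hexp]
      refine Real.exp_le_exp.2 ?_
      push_cast
      nlinarith [mul_le_mul_of_nonneg_right hp (by linarith : (0 : ℝ) ≤ d)]
    refine (Finset.sum_le_card_nsmul _ _ _ hterm).trans ?_
    rw [Nat.card_Icc, Nat.add_sub_cancel, nsmul_eq_mul, ← mul_assoc]
    refine mul_le_of_le_one_left (by positivity) ?_
    rw [mul_one_div, div_le_one hn0']
    linarith
  refine (measureReal_mono hsub (measure_ne_top _ _)).trans ((measureReal_union_le _ _).trans ?_)
  calc _ ≤ 1 / (n : ℝ) + 1 / n := add_le_add hjoin hexpands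
    _ = 2 / n := by ring

theorem withHighProb_of_measureReal_compl_le {p : ℕ → unitInterval}
    {P : ∀ n : ℕ, Set (SimpleGraph (Fin n))} {ε : ℕ → ℝ}
    (h : ∀ᶠ n in atTop, (binomialRandom (Fin n) (p n)).real (P n)ᶜ ≤ ε n)
    (hε : Tendsto ε atTop (𝓝 0)) : WithHighProb p P := by
  have h1 : Tendsto (fun n => (binomialRandom (Fin n) (p n)).real (P n)) atTop (𝓝 1) := by
    have h2 : Tendsto (fun n => 1 - ε n) atTop (𝓝 1) := by simpa using hε.const_sub 1
    refine tendsto_of_tendsto_of_tendsto_of_le_of_le' h2 tendsto_const_nhds ?_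
      (Eventually.of_forall fun n => measureReal_le_one)
    filter_upwards [h] with n hn
    rw [probReal_compl_eq_one_sub (Set.toFinite _).measurableSet] at hn
    linarith
  have h2 := ENNReal.tendsto_ofReal h1
  simpa [WithHighProb, ofReal_measureReal] using h2

theorem withHighProb_tc_three_le_three (p : ℕ → unitInterval)
    (hp : ∀ᶠ n : ℕ in atTop, 6 * (Real.log n / n) ^ (1 / 4 : ℝ) < (p n : ℝ)) :
    WithHighProb p fun _ => {G | tc 3 G ≤ 3} := by
  refine withHighProb_of_measureReal_compl_le (ε := fun n => 2 / (n : ℝ)) ?_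
    (tendsto_const_div_atTop_nhds_zero_nat 2)
  have hlog : ∀ᶠ n : ℕ in atTop, 1 ≤ Real.log n :=
    (Real.tendsto_log_atTop.comp tendsto_natCast_atTop_atTop).eventually_ge_atTop 1
  filter_upwards [hp, hlog, eventually_gt_atTop 0] with n hpn hlogn hn
  have hn' : (0 : ℝ) < n := Nat.cast_pos.2 hn
  have h := measureReal_not_tc_three_le_three_le (V := Fin n) (p n) (by simpa using hlogn) ?_
  · rw [Nat.card_eq_fintype_card, Fintype.card_fin] at h
    exact h
  · rw [Nat.card_eq_fintype_card, Fintype.card_fin]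
    have hq : 0 ≤ Real.log n / n := by positivity
    have h1 : (6 * (Real.log n / n) ^ (1 / 4 : ℝ)) ^ 4 ≤ (p n : ℝ) ^ 4 :=
      pow_le_pow_left₀ (by positivity) hpn.le 4
    rw [mul_pow, ← Real.rpow_natCast ((Real.log n / n) ^ (1 / 4 : ℝ)), ← Real.rpow_mul hq] at h1
    norm_num at h1
    rw [← mul_div_assoc, div_le_iff₀ hn'] at h1
    linarith

end UpperBoundAssembly

/-! ### Below the threshold: many disjoint quadruples. -/

section LowerBound

open MeasureTheory ProbabilityTheory
open SimpleGraph (binomialRandom)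

variable {V : Type*}

theorem dependsOnEdges_exists_common_neighbour (T : Finset V) (U : Set V) :
    DependsOnEdges {G : SimpleGraph V | ∃ u ∈ U, ∀ w ∈ T, G.Adj w u}
      (⋃ u ∈ U, starEdges (T : Set V) u) := by
  rintro G H hGH ⟨u, hu, h⟩
  refine ⟨u, hu, fun w hw => ?_⟩
  have := hGH s(w, u) (Set.mem_iUnion₂.2 ⟨u, hu, w, hw, rfl⟩)
  exact this.1 (h w hw)

theorem measureReal_exists_common_neighbour_le [Finite V] (p : unitInterval) {T : Finset V}
    {U : Set V} (hTU : ∀ u ∈ U, u ∉ T) :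
    (binomialRandom V p).real {G | ∃ u ∈ U, ∀ w ∈ T, G.Adj w u} ≤
      1 - (1 - (p : ℝ) ^ T.card) ^ Nat.card V := by
  classical
  have := Fintype.ofFinite V
  have hp : (p : ℝ) ^ T.card ≤ 1 := pow_le_one₀ p.2.1 p.2.2
  have hp' : 0 ≤ (p : ℝ) ^ T.card := pow_nonneg p.2.1 _
  have h : {G : SimpleGraph V | ∃ u ∈ U, ∀ w ∈ T, G.Adj w u} =
      (⋂ u ∈ U.toFinset, {G | ∀ w ∈ T, G.Adj w u}ᶜ)ᶜ := by
    ext G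
    simp
  rw [h, probReal_compl_eq_one_sub (Set.toFinite _).measurableSet,
    measureReal_biInter_of_dependsOnEdges (F := fun u => starEdges (T : Set V) u)
      (fun u _ => (dependsOnEdges_forall_adj T u).compl)
      (fun u _ u' hu' huu' => disjoint_starEdges (hTU u' (by simpa using hu')) huu'),
    Finset.prod_congr rfl fun u hu => by
      rw [probReal_compl_eq_one_sub (Set.toFinite _).measurableSet,
        measureReal_forall_adj p (hTU u (by simpa using hu))], Finset.prod_const]
  refine sub_le_sub_left (pow_le_pow_of_le_one (by linarith) (by linarith) ?_) 1
  rw [Nat.card_eq_fintype_card]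
  exact Finset.card_le_univ _

/-- The three terms bound an edge inside some quadruple (S₁), a quadruple vertex that is a common
neighbour of a quadruple (S₂), and every quadruple having a common neighbour outside all of them
(S₃). Restricting S₃ to `U` makes the edge sets of distinct quadruples disjoint, so its events are
independent. -/
theorem measureReal_tc_three_le_three_le [Finite V] (p : unitInterval) {m : ℕ}
    {v : Fin m → Fin 4 → V} (hv : ∀ i j i' j', v i j = v i' j' → i = i' ∧ j = j') :
    (binomialRandom V p).real {G | tc 3 G ≤ 3} ≤
      6 * m * p + 4 * m ^ 2 * (p : ℝ) ^ 4 + (1 - (1 - (p : ℝ) ^ 4) ^ Nat.card V) ^ m := by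
  classical
  let T : Fin m → Finset V := fun i => Finset.univ.image (v i)
  let U : Set V := {u | ∀ i j, u ≠ v i j}
  have hT : ∀ i, (T i).card = 4 := by
    intro i
    rw [Finset.card_image_of_injective _ fun j j' h => (hv _ _ _ _ h).2]
    simp
  let P : Finset (Fin 4 × Fin 4) := Finset.univ.filter fun q => q.1 < q.2
  let S₁ : Set (SimpleGraph V) :=
    ⋃ q ∈ (Finset.univ : Finset (Fin m)) ×ˢ P, {G | s(v q.1 q.2.1, v q.1 q.2.2) ∈ G.edgeSet}
  let S₂ : Set (SimpleGraph V) :=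
    ⋃ q ∈ (Finset.univ : Finset (Fin m × Fin m × Fin 4)),
      {G | ∀ w ∈ T q.1, G.Adj w (v q.2.1 q.2.2)}
  let S₃ : Set (SimpleGraph V) :=
    ⋂ i ∈ (Finset.univ : Finset (Fin m)), {G | ∃ u ∈ U, ∀ w ∈ T i, G.Adj w u}
  have hsub : {G : SimpleGraph V | tc 3 G ≤ 3} ⊆ S₁ ∪ S₂ ∪ S₃ := by
    intro G hG
    by_contra hG'
    simp only [Set.mem_union, not_or] at hG'
    obtain ⟨⟨h1, h2⟩, h3⟩ := hG'
    simp only [S₃, Set.mem_iInter, Finset.mem_univ, forall_const, not_forall, Set.mem_ofPred_eq,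
      not_exists, not_and] at h3
    obtain ⟨i, hi⟩ := h3
    have hne : ∀ j j', j ≠ j' → v i j ≠ v i j' := fun j j' hj h => hj (hv _ _ _ _ h).2
    have hind : ∀ j j', j < j' → ¬ G.Adj (v i j) (v i j') := by
      intro j j' hj hadj
      exact h1 (Set.mem_iUnion₂.2 ⟨(i, j, j'), by simp [P, hj], hadj⟩)
    refine four_le_tc_three_of_no_common_neighbour (a := v i 0) (b := v i 1) (d := v i 2)
      (e := v i 3) ⟨hne _ _ (by decide), hne _ _ (by decide), hne _ _ (by decide),
        hne _ _ (by decide), hne _ _ (by decide), hne _ _ (by decide)⟩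
      ⟨hind _ _ (by decide), hind _ _ (by decide), hind _ _ (by decide), hind _ _ (by decide),
        hind _ _ (by decide), hind _ _ (by decide)⟩ ?_ hG
    intro u ha hb hd he
    have hall : ∀ w ∈ T i, G.Adj w u := by
      intro w hw
      obtain ⟨j, -, rfl⟩ := Finset.mem_image.1 hw
      fin_cases j
      exacts [ha, hb, hd, he]
    by_cases hu : u ∈ U
    · obtain ⟨w, hw, hwu⟩ := hi u hu
      exact hwu (hall w hw)
    · simp only [U, Set.mem_ofPred_eq, not_forall, not_not] at hu
      obtain ⟨i', j', rfl⟩ := hu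
      exact h2 (Set.mem_iUnion₂.2 ⟨(i, i', j'), by simp, hall⟩)
  have h₁ : (binomialRandom V p).real S₁ ≤ 6 * m * p := by
    refine (measureReal_biUnion_finset_le _ _).trans ?_
    have hterm : ∀ q ∈ (Finset.univ : Finset (Fin m)) ×ˢ P,
        (binomialRandom V p).real {G | s(v q.1 q.2.1, v q.1 q.2.2) ∈ G.edgeSet} = p := by
      rintro ⟨i, j, j'⟩ hq
      simp only [P, Finset.mem_product, Finset.mem_univ, Finset.mem_filter, true_and] at hq
      refine binomialRandom_real_mem_edgeSet p ?_
      rw [Sym2.mk_isDiag_iff]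
      exact fun h => hq.ne (hv _ _ _ _ h).2
    have hP : P.card = 6 := by decide
    rw [Finset.sum_congr rfl hterm, Finset.sum_const, Finset.card_product, hP, Finset.card_univ,
      Fintype.card_fin, nsmul_eq_mul]
    push_cast
    exact le_of_eq (by ring)
  have h₂ : (binomialRandom V p).real S₂ ≤ 4 * m ^ 2 * (p : ℝ) ^ 4 := by
    refine (measureReal_biUnion_finset_le _ _).trans ?_
    have hterm : ∀ q ∈ (Finset.univ : Finset (Fin m × Fin m × Fin 4)),
        (binomialRandom V p).real {G | ∀ w ∈ T q.1, G.Adj w (v q.2.1 q.2.2)} ≤ (p : ℝ) ^ 4 := by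
      rintro ⟨i, i', j'⟩ -
      by_cases hu : v i' j' ∈ T i
      · have : {G : SimpleGraph V | ∀ w ∈ T i, G.Adj w (v i' j')} = ∅ := by
          ext G
          simp only [Set.mem_ofPred_eq, Set.mem_empty_iff_false, iff_false]
          exact fun h => (h _ hu).ne rfl
        simp only [this, measureReal_empty]
        exact pow_nonneg p.2.1 4
      · rw [measureReal_forall_adj p hu, hT]
    refine (Finset.sum_le_card_nsmul _ _ _ hterm).trans ?_
    rw [nsmul_eq_mul, Finset.card_univ]
    simp only [Fintype.card_prod, Fintype.card_fin]
    push_cast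
    exact le_of_eq (by ring)
  have hUT : ∀ i, ∀ u ∈ U, u ∉ T i := by
    intro i u hu huT
    obtain ⟨j, -, rfl⟩ := Finset.mem_image.1 huT
    exact hu i j rfl
  have h₃ : (binomialRandom V p).real S₃ ≤ (1 - (1 - (p : ℝ) ^ 4) ^ Nat.card V) ^ m := by
    rw [measureReal_biInter_of_dependsOnEdges
      (fun i _ => dependsOnEdges_exists_common_neighbour (T i) U)]
    · refine (Finset.prod_le_prod (fun i _ => measureReal_nonneg) fun i _ =>
        measureReal_exists_common_neighbour_le p (hUT i)).trans ?_
      simp [hT]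
    · intro i _ i' _ hii'
      rw [Function.onFun, Set.disjoint_left]
      intro e he he'
      obtain ⟨u, hu, w, hw, rfl⟩ := Set.mem_iUnion₂.1 he
      obtain ⟨u', hu', w', hw', h⟩ := Set.mem_iUnion₂.1 he'
      rcases Sym2.eq_iff.1 h with ⟨rfl, -⟩ | ⟨rfl, -⟩
      · obtain ⟨j, -, rfl⟩ := Finset.mem_image.1 hw
        obtain ⟨j', -, h'⟩ := Finset.mem_image.1 hw'
        exact hii' (hv _ _ _ _ h').1.symm
      · exact hUT i' _ hu hw'
  refine (measureReal_mono hsub (measure_ne_top _ _)).trans ((measureReal_union_le _ _).trans ?_)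
  exact add_le_add ((measureReal_union_le _ _).trans (add_le_add h₁ h₂)) h₃

/-- The scale x = n^(1/16) with m ≈ x² quadruples balances the terms: p ≤ x^(-3) makes the first two
O(1/x), while each quadruple lacks an outside common neighbour with probability at least 1/x, so all
m fail with probability at most exp(-m/x) ≤ exp(-x/2). -/
theorem measureReal_tc_three_le_three_le_div {n : ℕ} (p : unitInterval) {x : ℝ} (hx : 2 ≤ x)
    (hn : (n : ℝ) = x ^ 16) (hlog : Real.log n ≤ x ^ 4)
    (hp : 81 * (n * (p : ℝ) ^ 4) ≤ Real.log n) :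
    (binomialRandom (Fin n) p).real {G | tc 3 G ≤ 3} ≤ 12 / x := by
  have hp0 : (0 : ℝ) ≤ p := p.2.1
  have hx0 : 0 < x := by linarith
  set m := ⌊x ^ 2⌋₊ with hm
  have hm1 : (m : ℝ) ≤ x ^ 2 := Nat.floor_le (by positivity)
  have hm2 : x ^ 2 / 2 ≤ m := by
    have := Nat.lt_floor_add_one (x ^ 2)
    nlinarith
  have hmn : m * 4 ≤ n := by
    have h1 : (2 : ℝ) ^ 14 ≤ x ^ 14 := pow_le_pow_left₀ (by norm_num) hx 14
    have h2 : (m * 4 : ℝ) ≤ n := by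
      rw [hn]
      nlinarith [pow_pos hx0 2]
    exact_mod_cast h2
  have hlt : ∀ (i : Fin m) (j : Fin 4), 4 * (i : ℕ) + j < n := by
    intro i j
    have := i.2
    have := j.2
    omega
  have h := measureReal_tc_three_le_three_le p (v := fun (i : Fin m) (j : Fin 4) =>
    (⟨4 * i + j, hlt i j⟩ : Fin n)) (by
      intro i j i' j' h
      simp only [Fin.mk.injEq] at h
      have := j.2
      have := j'.2
      constructor <;> ext <;> omega)
  rw [Nat.card_eq_fintype_card, Fintype.card_fin] at h
  have hp4 : (p : ℝ) ^ 4 * x ^ 12 ≤ 1 := by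
    have h1 : (p : ℝ) ^ 4 * x ^ 12 * x ^ 4 ≤ 1 * x ^ 4 := by
      have : (p : ℝ) ^ 4 * x ^ 12 * x ^ 4 = n * (p : ℝ) ^ 4 := by rw [hn]; ring
      rw [this]
      have : 0 ≤ n * (p : ℝ) ^ 4 := by positivity
      linarith
    exact le_of_mul_le_mul_right h1 (by positivity)
  have hp3 : (p : ℝ) * x ^ 3 ≤ 1 := by
    have h1 : ((p : ℝ) * x ^ 3) ^ 4 ≤ 1 := by
      rw [mul_pow, ← pow_mul]
      exact hp4
    exact (pow_le_one_iff_of_nonneg (by positivity) (by norm_num)).1 h1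
  have hfirst : 6 * m * (p : ℝ) ≤ 6 / x := by
    rw [le_div_iff₀ hx0]
    have : m * (p : ℝ) * x ≤ x ^ 2 * p * x := by gcongr
    nlinarith
  have hsecond : 4 * (m : ℝ) ^ 2 * (p : ℝ) ^ 4 ≤ 4 / x := by
    rw [le_div_iff₀ hx0]
    have h1 : (m : ℝ) ^ 2 * (p : ℝ) ^ 4 * x ≤ (x ^ 2) ^ 2 * (p : ℝ) ^ 4 * x := by gcongr
    have h2 : (x ^ 2) ^ 2 * (p : ℝ) ^ 4 * x ≤ (p : ℝ) ^ 4 * x ^ 12 := by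
      have : x ^ 5 ≤ x ^ 12 := pow_le_pow_right₀ (by linarith) (by norm_num)
      calc (x ^ 2) ^ 2 * (p : ℝ) ^ 4 * x = (p : ℝ) ^ 4 * x ^ 5 := by ring
        _ ≤ (p : ℝ) ^ 4 * x ^ 12 := by gcongr
    linarith
  have hthird : (1 - (1 - (p : ℝ) ^ 4) ^ n) ^ m ≤ 2 / x := by
    have hn0 : (0 : ℝ) < n := by rw [hn]; positivity
    have hhalf : 2 * (p : ℝ) ^ 4 ≤ 1 := by
      have : (2 : ℝ) ^ 12 ≤ x ^ 12 := pow_le_pow_left₀ (by norm_num) hx 12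
      nlinarith [pow_nonneg hp0 4]
    -- The left side is exp(-(log n) / 16), and 2 n p^4 ≤ (2/81) log n is below (log n) / 16.
    have h1 : 1 / x ≤ (1 - (p : ℝ) ^ 4) ^ n := by
      have h2 : Real.exp (-(2 * (p : ℝ) ^ 4)) ≤ 1 - (p : ℝ) ^ 4 := by
        have := exp_neg_le_one_sub_half (by positivity) hhalf
        linarith
      refine le_trans ?_ (pow_le_pow_left₀ (Real.exp_pos _).le h2 n)
      rw [← Real.exp_nat_mul]
      have hlogx : Real.log n = 16 * Real.log x := by
        rw [hn, Real.log_pow]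
        norm_num
      have : 1 / x = Real.exp (-Real.log x) := by
        rw [Real.exp_neg, Real.exp_log hx0, one_div]
      rw [this]
      refine Real.exp_le_exp.2 ?_
      have : 0 ≤ n * (p : ℝ) ^ 4 := by positivity
      nlinarith
    have h3 : (1 - (p : ℝ) ^ 4) ^ n ≤ 1 :=
      pow_le_one₀ (by linarith) (by linarith [pow_nonneg hp0 4])
    calc (1 - (1 - (p : ℝ) ^ 4) ^ n) ^ m ≤ (1 - 1 / x) ^ m :=
          pow_le_pow_left₀ (by linarith) (by linarith) m
      _ ≤ Real.exp (-(1 / x)) ^ m :=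
          pow_le_pow_left₀ (by linarith) (Real.one_sub_le_exp_neg _) m
      _ = Real.exp (-(m / x)) := by
          rw [← Real.exp_nat_mul]
          ring_nf
      _ ≤ Real.exp (-(x / 2)) := by
          refine Real.exp_le_exp.2 (neg_le_neg ?_)
          rw [le_div_iff₀ hx0]
          linarith
      _ ≤ 2 / x := by
          rw [Real.exp_neg, inv_le_comm₀ (Real.exp_pos _) (by positivity), inv_div]
          linarith [Real.add_one_le_exp (x / 2)]
  refine h.trans ((add_le_add (add_le_add hfirst hsecond) hthird).trans (le_of_eq ?_))
  ring

theorem withHighProb_not_tc_three_le_three (p : ℕ → unitInterval)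
    (hp : ∀ᶠ n : ℕ in atTop, (p n : ℝ) < 1 / 3 * (Real.log n / n) ^ (1 / 4 : ℝ)) :
    WithHighProb p fun _ => {G | tc 3 G ≤ 3}ᶜ := by
  have hx : Tendsto (fun n : ℕ => (n : ℝ) ^ (1 / 16 : ℝ)) atTop atTop :=
    (tendsto_rpow_atTop (by norm_num)).comp tendsto_natCast_atTop_atTop
  refine withHighProb_of_measureReal_compl_le (ε := fun n => 12 / (n : ℝ) ^ (1 / 16 : ℝ)) ?_
    (hx.const_div_atTop 12)
  have hlog : ∀ᶠ n : ℕ in atTop, ‖Real.log n‖ ≤ 1 * ‖(n : ℝ) ^ (1 / 4 : ℝ)‖ :=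
    tendsto_natCast_atTop_atTop.eventually
      ((isLittleO_log_rpow_atTop (r := 1 / 4) (by norm_num)).bound one_pos)
  filter_upwards [hp, hlog, hx.eventually_ge_atTop 2, eventually_gt_atTop 0] with n hpn hlogn hxn hn
  have hn' : (0 : ℝ) < n := Nat.cast_pos.2 hn
  have hlog0 : 0 ≤ Real.log n := Real.log_natCast_nonneg n
  rw [compl_compl]
  refine measureReal_tc_three_le_three_le_div (p n) hxn ?_ ?_ ?_
  · rw [← Real.rpow_natCast, ← Real.rpow_mul hn'.le]
    norm_num
  · rw [← Real.rpow_natCast, ← Real.rpow_mul hn'.le]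
    rw [Real.norm_of_nonneg hlog0, one_mul, Real.norm_of_nonneg (by positivity)] at hlogn
    norm_num
    norm_num at hlogn
    exact hlogn
  · have hq : 0 ≤ Real.log n / n := by positivity
    have h1 : (p n : ℝ) ^ 4 ≤ (1 / 3 * (Real.log n / n) ^ (1 / 4 : ℝ)) ^ 4 :=
      pow_le_pow_left₀ (p n).2.1 hpn.le 4
    rw [mul_pow, ← Real.rpow_natCast ((Real.log n / n) ^ (1 / 4 : ℝ)), ← Real.rpow_mul hq] at h1
    norm_num at h1
    rw [← mul_div_assoc, le_div_iff₀ hn'] at h1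
    linarith

end LowerBound

theorem theorem1p1 :
    IsThreshold (fun n : ℕ => {G : SimpleGraph (Fin n) | tc 3 G ≤ 3})
      (fun n : ℕ => (Real.log n / n) ^ (1 / 4 : ℝ)) := by
  -- The constants satisfy 6^4 = 1296 and (1/3)^4 = 1/81, the factors required of n p^4 / log n on
  -- the two sides.
  refine ⟨fun _ _ _ hGH hG => tc_mono (m := 3) hGH hG, fun n => ?_, 6, 1 / 3, by norm_num,
    by norm_num, withHighProb_tc_three_le_three, withHighProb_not_tc_three_le_three⟩
  · have h0 : 0 ≤ Real.log n / n := div_nonneg (Real.log_natCast_nonneg n) (Nat.cast_nonneg n)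
    refine ⟨Real.rpow_nonneg h0 _, Real.rpow_le_one h0 ?_ (by norm_num)⟩
    refine div_le_one_of_le₀ ?_ (Nat.cast_nonneg n)
    exact Real.log_le_self (Nat.cast_nonneg n)
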